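/- Let $0<\alpha,\beta<1$, let $w(x)=(1-x)^{\alpha}(1+x)^{\beta}$ and $p(x)=(1-x)^{\alpha+1}(1+x)^{\beta+1}$ on $(-1,1)$, and consider the Jacobi differential expression $\ell[f]=-\frac1w(pf')'$ in the Hilbert space $\mathfrak h=L^2((-1,1),w\,dx)$, with $\langle f,g\rangle=\int_{-1}^1 f\overline g\,w\,dx$. Its maximal domain is $$\mathcal D_{\max}=\{f\in\mathfrak h : f,f'\in AC_{\rm loc}(-1,1),\ \ell[f]\in\mathfrak h\}.$$ For functions $f,g$ put $[f,g](x)=p(x)\big(f(x)\overline{g'(x)}-f'(x)\overline{g(x)}\big)$, and let $[f,g](\pm1)$ be the limits at the endpoints (which exist for $f,g\in\mathcal D_{\max}$). Let $\mathcal D_{\min}$ be the set of $f\in\mathcal D_{\max}$ with $[f,g](1)-[f,g](-1)=0$ for all $g\in\mathcal D_{\max}$. Let $L_{\max}$ and $L_{\min}$ be the operators $f\mapsto\ell[f]$ in $\mathfrak h$ with domains $\mathcal D_{\max}$ and $\mathcal D_{\min}$, identified with their graphs. Let $v:(-1,1)\to\mathbb R$ be any $C^2$ function with $$v(x)=\frac{(1+x)^{-\beta}}{\beta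 2^{\alpha+1}}\ \text{ for $x$ near $-1$},\qquad v(x)=\frac{(1-x)^{-\alpha}}{\alpha 2^{\beta+1}}\ \text{ for $x$ near $1$},$$ and set $f^*(\pm1)=[f,v](\pm1)$. Theorem. $L_{\min}$ is closed and symmetric and $L_{\min}^*=L_{\max}$. For every $f\in\mathcal D_{\max}$ all limits in $$\Gamma_0f=\begin{pmatrix}f^*(-1)\\ f^*(1)\end{pmatrix}=\begin{pmatrix}\lim_{x\to-1^+}\big(-f(x)-\frac{(1+x)f'(x)}{\beta}\big)\\ \lim_{x\to1^-}\big(f(x)-\frac{(1-x)f'(x)}{\alpha}\big)\end{pmatrix},$$ $$\Gamma_1f=\begin{pmatrix}\lim_{x\to-1^+}\frac{f(x)}{v(x)}\\ \lim_{x\to1^-}-\frac{f(x)}{v(x)}\end{pmatrix}=\begin{pmatrix}\lim_{x\to-1^+}\beta2^{\alpha+1}(1+x)^{\beta}f(x)\\ \lim_{x\to1^-}-\alpha2^{\beta+1}(1-x)^{\alpha}f(x)\end{pmatrix}$$ exist and are finite, and these equalities hold. Moreover $\{\mathbb C^2,\Gamma_0,\Gamma_1\}$ is a boundary triple for $\mathcal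 D_{\max}$, that is, for $L_{\min}^*=L_{\max}$: the maps $\Gamma_0,\Gamma_1$ are linear, the map $f\mapsto(\Gamma_0f,\Gamma_1f)$ from $\mathcal D_{\max}$ to $\mathbb C^2\times\mathbb C^2$ is surjective, and for all $f,g\in\mathcal D_{\max}$ $$\langle\ell[f],g\rangle-\langle f,\ell[g]\rangle=\langle\Gamma_1f,\Gamma_0g\rangle_{\mathbb C^2}-\langle\Gamma_0f,\Gamma_1g\rangle_{\mathbb C^2}.$$ -/

import Mathlib

open Filter Topology MeasureTheory Set
open scoped ComplexConjugate

noncomputable section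

/-- `{G, Γ₀, Γ₁}` is a boundary triple for `S*`, where `S` is a closed symmetric linear relation
in the Hilbert space `H`. Mathlib's inner product is conjugate linear in the *first* argument,
so the textbook `⟨a, b⟩` (linear in `a`) reads `inner ℂ b a` below. -/
structure IsBoundaryTriple {H G : Type*}
    [NormedAddCommGroup H] [InnerProductSpace ℂ H] [CompleteSpace H]
    [NormedAddCommGroup G] [InnerProductSpace ℂ G] [CompleteSpace G]
    (S : Submodule ℂ (H × H)) (Γ₀ Γ₁ : S.adjoint →ₗ[ℂ] G) : Prop where
  isClosed : IsClosed (S : Set (H × H))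
  symmetric : S ≤ S.adjoint
  surjective : Function.Surjective fun z : S.adjoint => (Γ₀ z, Γ₁ z)
  green : ∀ f g : S.adjoint,
    inner ℂ (g : H × H).1 (f : H × H).2 - inner ℂ (g : H × H).2 (f : H × H).1 =
      inner ℂ (Γ₀ g) (Γ₁ f) - inner ℂ (Γ₁ g) (Γ₀ f)

/-- Local absolute continuity on the open interval `(a, b)`. -/
def ACLocOn (f : ℝ → ℂ) (a b : ℝ) : Prop :=
  ∀ c ∈ Ioo a b, ∀ d ∈ Ioo a b, AbsolutelyContinuousOnInterval f c d

/-- The weight `(1 - x)^α (1 + x)^β`. -/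
def jacobiWeight (α β x : ℝ) : ℝ := (1 - x) ^ α * (1 + x) ^ β

/-- The leading coefficient `(1 - x)^(α + 1) (1 + x)^(β + 1)`. -/
def jacobiCoeff (α β x : ℝ) : ℝ := (1 - x) ^ (α + 1) * (1 + x) ^ (β + 1)

/-- The weighted measure `(1 - x)^α (1 + x)^β dx` on `(-1, 1)`. -/
def jacobiMeasure (α β : ℝ) : Measure ℝ :=
  (volume.restrict (Ioo (-1) 1)).withDensity fun x => ENNReal.ofReal (jacobiWeight α β x)

/-- The Hilbert space `L²((-1, 1), (1 - x)^α (1 + x)^β)`. -/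
abbrev JacobiL2 (α β : ℝ) : Type := Lp ℂ 2 (jacobiMeasure α β)

/-- The Jacobi differential expression
`ℓ[f](x) = -((1 - x)^α (1 + x)^β)⁻¹ ((1 - x)^(α + 1) (1 + x)^(β + 1) f'(x))'`. -/
def jacobiExpr (α β : ℝ) (f : ℝ → ℂ) (x : ℝ) : ℂ :=
  -((jacobiWeight α β x)⁻¹ • deriv (fun t => jacobiCoeff α β t • deriv f t) x)

/-- The sesquilinear form
`[f, g](x) = (1 - x)^(α + 1) (1 + x)^(β + 1) (f(x) conj (g'(x)) - f'(x) conj (g(x)))`. -/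
def jacobiForm (α β : ℝ) (f g : ℝ → ℂ) (x : ℝ) : ℂ :=
  jacobiCoeff α β x • (f x * conj (deriv g x) - deriv f x * conj (g x))

/-- Membership in the maximal domain; only the values of `f` on `(-1, 1)` matter. Differentiability
on `(-1, 1)` is spelled out so that `deriv f` is the genuine derivative `f'` there. -/
structure InJacobiMax (α β : ℝ) (f : ℝ → ℂ) : Prop where
  differentiableAt : ∀ x ∈ Ioo (-1 : ℝ) 1, DifferentiableAt ℝ f x
  acLoc : ACLocOn f (-1) 1
  acLoc_deriv : ACLocOn (deriv f) (-1) 1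
  memLp : MemLp f 2 (jacobiMeasure α β)
  memLp_expr : MemLp (jacobiExpr α β f) 2 (jacobiMeasure α β)

theorem ACLocOn.ae_differentiableAt {f : ℝ → ℂ} {a b : ℝ} (hf : ACLocOn f a b) :
    ∀ᵐ x, x ∈ Ioo a b → DifferentiableAt ℝ f x := by
  have h : ∀ q : ℚ × ℚ, ∀ᵐ x, ((q.1 : ℝ) ∈ Ioo a b ∧ (q.2 : ℝ) ∈ Ioo a b) →
      x ∈ uIcc (q.1 : ℝ) q.2 → DifferentiableAt ℝ f x := by
    intro q
    by_cases hq : (q.1 : ℝ) ∈ Ioo a b ∧ (q.2 : ℝ) ∈ Ioo a b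
    · filter_upwards [(hf _ hq.1 _ hq.2).boundedVariationOn.ae_differentiableAt_of_mem_uIcc]
        with x hx _ using hx
    · exact Eventually.of_forall fun x hx => absurd hx hq
  filter_upwards [ae_all_iff.2 h] with x hx hxab
  obtain ⟨c, hac, hcx⟩ := exists_rat_btwn hxab.1
  obtain ⟨d, hxd, hdb⟩ := exists_rat_btwn hxab.2
  exact hx (c, d) ⟨⟨hac, hcx.trans hxab.2⟩, ⟨hxab.1.trans hxd, hdb⟩⟩
    (mem_uIcc.2 (Or.inl ⟨hcx.le, hxd.le⟩))

theorem differentiableAt_jacobiCoeff (α β : ℝ) {x : ℝ} (hx : x ∈ Ioo (-1 : ℝ) 1) :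
    DifferentiableAt ℝ (jacobiCoeff α β) x := by
  have h1 : (1 - x) ≠ 0 := by linarith [hx.2]
  have h2 : (1 + x) ≠ 0 := by linarith [hx.1]
  unfold jacobiCoeff
  exact (((differentiableAt_const _).sub differentiableAt_id).rpow_const (Or.inl h1)).mul
    (((differentiableAt_const _).add differentiableAt_id).rpow_const (Or.inl h2))

theorem ae_jacobiMeasure_of_ae {α β : ℝ} {P : ℝ → Prop}
    (h : ∀ᵐ x, x ∈ Ioo (-1 : ℝ) 1 → P x) : ∀ᵐ x ∂jacobiMeasure α β, P x :=
  (withDensity_absolutelyContinuous _ _).ae_le ((ae_restrict_iff' measurableSet_Ioo).2 h)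

namespace InJacobiMax

variable {α β : ℝ} {f g : ℝ → ℂ}

theorem ae_differentiableAt (hf : InJacobiMax α β f) :
    ∀ᵐ x, x ∈ Ioo (-1 : ℝ) 1 →
      DifferentiableAt ℝ (fun t => jacobiCoeff α β t • deriv f t) x := by
  filter_upwards [hf.acLoc_deriv.ae_differentiableAt] with x hx hxI
  exact (differentiableAt_jacobiCoeff α β hxI).smul (hx hxI)

theorem deriv_add_eq (hf : InJacobiMax α β f) (hg : InJacobiMax α β g) {x : ℝ}
    (hx : x ∈ Ioo (-1 : ℝ) 1) : deriv (f + g) x = deriv f x + deriv g x :=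
  deriv_add (hf.differentiableAt x hx) (hg.differentiableAt x hx)

theorem deriv_smul_eq (c : ℂ) (hf : InJacobiMax α β f) {x : ℝ}
    (hx : x ∈ Ioo (-1 : ℝ) 1) : deriv (c • f) x = c • deriv f x :=
  deriv_const_smul c (hf.differentiableAt x hx)

theorem expr_add (hf : InJacobiMax α β f) (hg : InJacobiMax α β g) :
    jacobiExpr α β (f + g) =ᵐ[jacobiMeasure α β] jacobiExpr α β f + jacobiExpr α β g := by
  refine ae_jacobiMeasure_of_ae ?_
  filter_upwards [hf.ae_differentiableAt, hg.ae_differentiableAt] with x h1 h2 hx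
  have : (fun t => jacobiCoeff α β t • deriv (f + g) t) =ᶠ[𝓝 x]
      (fun t => jacobiCoeff α β t • deriv f t) + fun t => jacobiCoeff α β t • deriv g t := by
    filter_upwards [isOpen_Ioo.mem_nhds hx] with t ht
    simp [hf.deriv_add_eq hg ht]
  simp only [jacobiExpr, Pi.add_apply]
  rw [this.deriv_eq, deriv_add (h1 hx) (h2 hx), smul_add, neg_add]

theorem expr_smul (c : ℂ) (hf : InJacobiMax α β f) :
    jacobiExpr α β (c • f) =ᵐ[jacobiMeasure α β] c • jacobiExpr α β f := by
  refine ae_jacobiMeasure_of_ae ?_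
  filter_upwards [hf.ae_differentiableAt] with x h1 hx
  have : (fun t => jacobiCoeff α β t • deriv (c • f) t) =ᶠ[𝓝 x]
      c • fun t => jacobiCoeff α β t • deriv f t := by
    filter_upwards [isOpen_Ioo.mem_nhds hx] with t ht
    simp only [hf.deriv_smul_eq c ht, Pi.smul_apply]
    exact smul_comm _ _ _
  simp only [jacobiExpr, Pi.smul_apply]
  rw [this.deriv_eq, deriv_const_smul c (h1 hx), smul_neg, smul_comm]

end InJacobiMax

theorem ACLocOn.congr {f g : ℝ → ℂ} {a b : ℝ} (hf : ACLocOn f a b)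
    (h : EqOn f g (Ioo a b)) : ACLocOn g a b := by
  intro c hc d hd
  have hsub : uIcc c d ⊆ Ioo a b := ordConnected_Ioo.uIcc_subset hc hd
  refine (tendsto_congr' ?_).1 (hf c hc d hd)
  refine mem_inf_of_right ?_
  intro E hE
  refine Finset.sum_congr rfl fun i hi => ?_
  rw [h (hsub (hE.1 i hi).1), h (hsub (hE.1 i hi).2)]

theorem InJacobiMax.add {α β : ℝ} {f g : ℝ → ℂ} (hf : InJacobiMax α β f)
    (hg : InJacobiMax α β g) : InJacobiMax α β (f + g) where
  differentiableAt x hx := (hf.differentiableAt x hx).add (hg.differentiableAt x hx)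
  acLoc c hc d hd := (hf.acLoc c hc d hd).add (hg.acLoc c hc d hd)
  acLoc_deriv := ACLocOn.congr (f := deriv f + deriv g)
    (fun c hc d hd => (hf.acLoc_deriv c hc d hd).add (hg.acLoc_deriv c hc d hd))
    fun _ hx => (hf.deriv_add_eq hg hx).symm
  memLp := hf.memLp.add hg.memLp
  memLp_expr := (hf.memLp_expr.add hg.memLp_expr).ae_eq (hf.expr_add hg).symm

theorem InJacobiMax.smul {α β : ℝ} {f : ℝ → ℂ} (c : ℂ) (hf : InJacobiMax α β f) :
    InJacobiMax α β (c • f) where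
  differentiableAt x hx := (hf.differentiableAt x hx).const_smul c
  acLoc a ha d hd := (hf.acLoc a ha d hd).const_smul c
  acLoc_deriv := ACLocOn.congr (f := c • deriv f)
    (fun a ha d hd => (hf.acLoc_deriv a ha d hd).const_smul c)
    fun _ hx => (hf.deriv_smul_eq c hx).symm
  memLp := hf.memLp.const_smul c
  memLp_expr := (hf.memLp_expr.const_smul c).ae_eq (hf.expr_smul c).symm

theorem jacobiExpr_zero (α β : ℝ) : jacobiExpr α β 0 = 0 := by
  have h0 : deriv (0 : ℝ → ℂ) = 0 := by ext x; simp
  ext x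
  simp [jacobiExpr, h0]

theorem InJacobiMax.zero (α β : ℝ) : InJacobiMax α β 0 := by
  have h0 : deriv (0 : ℝ → ℂ) = 0 := by ext x; simp
  have hac : ACLocOn 0 (-1) 1 := by
    intro c _ d _
    simpa [AbsolutelyContinuousOnInterval] using tendsto_const_nhds
  refine ⟨fun x _ => differentiableAt_const _, hac, ?_, MemLp.zero, ?_⟩
  · rw [h0]
    exact hac
  · rw [jacobiExpr_zero]
    exact MemLp.zero

/-- The maximal domain of the Jacobi expression. -/
def jacobiDMax (α β : ℝ) : Submodule ℂ (ℝ → ℂ) where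
  carrier := {f | InJacobiMax α β f}
  add_mem' := InJacobiMax.add
  zero_mem' := InJacobiMax.zero α β
  smul_mem' c _ hf := InJacobiMax.smul c hf

/-- The minimal domain: all `f` in the maximal domain such that, for every `g` in the maximal
domain, the boundary values `[f, g](-1)` and `[f, g](1)` exist and agree. -/
def jacobiDMin (α β : ℝ) : Submodule ℂ (ℝ → ℂ) where
  carrier := {f | InJacobiMax α β f ∧ ∀ g, InJacobiMax α β g →
    ∃ c : ℂ, Tendsto (jacobiForm α β f g) (𝓝[>] (-1)) (𝓝 c) ∧
      Tendsto (jacobiForm α β f g) (𝓝[<] 1) (𝓝 c)}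
  add_mem' := by
    rintro f₁ f₂ ⟨h₁, k₁⟩ ⟨h₂, k₂⟩
    refine ⟨h₁.add h₂, fun g hg => ?_⟩
    obtain ⟨c₁, l₁, r₁⟩ := k₁ g hg
    obtain ⟨c₂, l₂, r₂⟩ := k₂ g hg
    have key : ∀ x ∈ Ioo (-1 : ℝ) 1, jacobiForm α β f₁ g x + jacobiForm α β f₂ g x =
        jacobiForm α β (f₁ + f₂) g x := by
      intro x hx
      simp only [jacobiForm, h₁.deriv_add_eq h₂ hx, Pi.add_apply, ← smul_add]
      congr 1
      ring
    refine ⟨c₁ + c₂, (l₁.add l₂).congr' ?_, (r₁.add r₂).congr' ?_⟩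
    · filter_upwards [Ioo_mem_nhdsGT (by norm_num : (-1 : ℝ) < 1)] with x hx using key x hx
    · filter_upwards [Ioo_mem_nhdsLT (by norm_num : (-1 : ℝ) < 1)] with x hx using key x hx
  zero_mem' := by
    have h0 : deriv (0 : ℝ → ℂ) = 0 := by ext x; simp
    have hz : ∀ g, jacobiForm α β 0 g = fun _ => 0 := by
      intro g
      ext x
      simp [jacobiForm, h0]
    refine ⟨InJacobiMax.zero α β, fun g _ => ⟨0, ?_⟩⟩
    rw [hz g]
    exact ⟨tendsto_const_nhds, tendsto_const_nhds⟩
  smul_mem' := by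
    rintro a f ⟨h, k⟩
    refine ⟨h.smul a, fun g hg => ?_⟩
    obtain ⟨c, l, r⟩ := k g hg
    have key : ∀ x ∈ Ioo (-1 : ℝ) 1, a * jacobiForm α β f g x =
        jacobiForm α β (a • f) g x := by
      intro x hx
      simp only [jacobiForm, h.deriv_smul_eq a hx, Pi.smul_apply, smul_eq_mul,
        Complex.real_smul]
      ring
    refine ⟨a * c, (l.const_mul a).congr' ?_, (r.const_mul a).congr' ?_⟩
    · filter_upwards [Ioo_mem_nhdsGT (by norm_num : (-1 : ℝ) < 1)] with x hx using key x hx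
    · filter_upwards [Ioo_mem_nhdsLT (by norm_num : (-1 : ℝ) < 1)] with x hx using key x hx

theorem jacobiDMin_le (α β : ℝ) : jacobiDMin α β ≤ jacobiDMax α β := fun _ hf => hf.1

/-- The graph `{(f, ℓ[f]) : f ∈ D}` in `L² × L²` of the Jacobi expression on a domain `D`
contained in the maximal domain. -/
def jacobiGraph (α β : ℝ) (D : Submodule ℂ (ℝ → ℂ)) (hD : D ≤ jacobiDMax α β) :
    Submodule ℂ (JacobiL2 α β × JacobiL2 α β) where
  carrier := {z | ∃ f ∈ D, z.1 =ᵐ[jacobiMeasure α β] f ∧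
    z.2 =ᵐ[jacobiMeasure α β] jacobiExpr α β f}
  add_mem' := by
    rintro z₁ z₂ ⟨f₁, h₁, a₁, b₁⟩ ⟨f₂, h₂, a₂, b₂⟩
    exact ⟨f₁ + f₂, D.add_mem h₁ h₂, (Lp.coeFn_add _ _).trans (a₁.add a₂),
      ((Lp.coeFn_add _ _).trans (b₁.add b₂)).trans
        (InJacobiMax.expr_add (hD h₁) (hD h₂)).symm⟩
  zero_mem' := by
    refine ⟨0, D.zero_mem, Lp.coeFn_zero _ _ _, ?_⟩
    rw [jacobiExpr_zero]
    exact Lp.coeFn_zero _ _ _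
  smul_mem' := by
    rintro c z ⟨f, h, a, b⟩
    exact ⟨c • f, D.smul_mem c h, (Lp.coeFn_smul _ _).trans (a.const_smul c),
      ((Lp.coeFn_smul _ _).trans (b.const_smul c)).trans
        (InJacobiMax.expr_smul c (hD h)).symm⟩

/-- The maximal Jacobi operator, as a linear relation. -/
def jacobiMax (α β : ℝ) : Submodule ℂ (JacobiL2 α β × JacobiL2 α β) :=
  jacobiGraph α β (jacobiDMax α β) le_rfl

/-- The minimal Jacobi operator, as a linear relation. -/
def jacobiMin (α β : ℝ) : Submodule ℂ (JacobiL2 α β × JacobiL2 α β) :=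
  jacobiGraph α β (jacobiDMin α β) (jacobiDMin_le α β)

end

/-! Write w for the weight, p for the coefficient, and q for `jacobiSecond`, so that p q' = 1.
Lagrange's identity [f,g]' = w (ℓ[f] conj g - f conj ℓ[g]) has an integrable right side for f, g in
the maximal domain. Integrating it gives the limits of [f,g] at ±1 and Green's formula
(`exists_tendsto_jacobiForm`). It also describes the minimal graph as the part of the maximal graph
orthogonal to the whole maximal graph for Green's form (`mem_jacobiMin_iff`), whence symmetry and
one inclusion for the adjoint.

For the other inclusion, the solutions 1 and q of ℓ[f] = 0 are both square integrable, because α, β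
< 1. Every F orthogonal to 1 and q is ℓ[f] for some f in the minimal domain: solve ℓ[f₀] = F, note
that [f₀,1] and [f₀,q] have equal values at the two ends, and remove these values by adding
multiples of q and 1 (`exists_mem_jacobiDMin`). If (x₁, x₂) is in the adjoint and ℓ[g] = x₂, then x₁
- g is orthogonal to all such F, hence lies in span {1, q}, and (x₁, x₂) is in the maximal graph.

The boundary maps are Γ₀ = [f,v](±1) and Γ₁ = [f,1](±1). The algebraic identity [f,g] · p v' = [f,1]
conj [g,v] - [f,v] conj [g,1] (`jacobiForm_mul_coeff_deriv`), with p v' → -1 at -1 and p v' → 1 at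
1, turns [f,g](1) - [f,g](-1) into the abstract Green identity. The explicit limits follow from the
form of v near each end, and surjectivity from gluing combinations of 1 and v. -/

noncomputable section

/-! ### Complex-valued absolutely continuous functions. -/

namespace AbsolutelyContinuousOnInterval

theorem const {F : Type*} [NormedAddCommGroup F] (c : F) (a b : ℝ) :
    AbsolutelyContinuousOnInterval (fun _ : ℝ => c) a b := by
  simpa [AbsolutelyContinuousOnInterval] using tendsto_const_nhds

theorem ofReal {f : ℝ → ℝ} {a b : ℝ} (hf : AbsolutelyContinuousOnInterval f a b) :
    AbsolutelyContinuousOnInterval (fun x => (f x : ℂ)) a b := by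
  simpa only [AbsolutelyContinuousOnInterval, Complex.dist_eq, Real.dist_eq, ← Complex.ofReal_sub,
    Complex.norm_real, Real.norm_eq_abs] using hf

theorem star {f : ℝ → ℂ} {a b : ℝ} (hf : AbsolutelyContinuousOnInterval f a b) :
    AbsolutelyContinuousOnInterval (fun x => conj (f x)) a b := by
  simpa [AbsolutelyContinuousOnInterval, Complex.dist_conj_conj] using hf

theorem intervalIntegral_complex {f : ℝ → ℂ} {a b c : ℝ} (h : IntervalIntegrable f volume a b)
    (hc : c ∈ uIcc a b) : AbsolutelyContinuousOnInterval (fun x => ∫ t in c..x, f t) a b := by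
  have hre : IntervalIntegrable (fun t => (f t).re) volume a b :=
    ⟨h.1.re, h.2.re⟩
  have him : IntervalIntegrable (fun t => (f t).im) volume a b :=
    ⟨h.1.im, h.2.im⟩
  have key := (hre.absolutelyContinuousOnInterval_intervalIntegral hc).ofReal.add
    ((him.absolutelyContinuousOnInterval_intervalIntegral hc).ofReal.const_smul Complex.I)
  have hset : ∀ x ∈ uIcc a b, (∫ t in c..x, f t) =
      ((∫ t in c..x, (f t).re : ℝ) : ℂ) + Complex.I • ((∫ t in c..x, (f t).im : ℝ) : ℂ) := by
    intro x hx
    have hcx : IntervalIntegrable f volume c x := h.mono_set (uIcc_subset_uIcc hc hx)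
    rw [← intervalIntegral.integral_ofReal, ← intervalIntegral.integral_ofReal,
      ← intervalIntegral.integral_smul, ← intervalIntegral.integral_add]
    · refine intervalIntegral.integral_congr fun t _ => ?_
      simp [mul_comm Complex.I]
    · exact ⟨hcx.1.re.ofReal, hcx.2.re.ofReal⟩
    · exact IntervalIntegrable.const_mul
        (f := fun t => (((f t).im : ℝ) : ℂ)) ⟨hcx.1.im.ofReal, hcx.2.im.ofReal⟩ Complex.I
  refine (tendsto_congr' ?_).1 key
  -- Absolute continuity only tests families of intervals with endpoints in `uIcc a b`, so agreement
  -- there is enough.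
  refine mem_inf_of_right ?_
  intro E hE
  refine Finset.sum_congr rfl fun i hi => ?_
  simp only [Pi.add_apply]
  rw [hset _ (hE.1 i hi).1, hset _ (hE.1 i hi).2]

/-- The fundamental theorem of calculus for complex absolutely continuous functions. -/
theorem integral_eq_sub_of_ae_hasDerivAt {f f' : ℝ → ℂ} {a b : ℝ}
    (hf : AbsolutelyContinuousOnInterval f a b) (hf' : IntervalIntegrable f' volume a b)
    (h : ∀ᵐ x, x ∈ uIcc a b → HasDerivAt f (f' x) x) : ∫ x in a..b, f' x = f b - f a := by
  -- The difference between f and the integral of f' is absolutely continuous with derivative zero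
  -- almost everywhere, hence constant.
  have hg := hf.sub (intervalIntegral_complex hf' (c := a) left_mem_uIcc)
  obtain ⟨C, hC⟩ := hg.const_of_ae_hasDerivAt_zero (by
    filter_upwards [h, hf'.ae_hasDerivAt_integral] with x h1 h2 hx
    have := (h1 hx).sub (h2 hx a left_mem_uIcc)
    rwa [sub_self] at this)
  have h1 := hC a left_mem_uIcc
  have h2 := hC b right_mem_uIcc
  simp only [Pi.sub_apply, intervalIntegral.integral_same, sub_zero] at h1 h2
  rw [h1, ← h2]
  ring

end AbsolutelyContinuousOnInterval

/-! ### The weighted measure and a square integrable majorant. -/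

section Weight

variable {α β : ℝ}

theorem jacobiWeight_pos {x : ℝ} (hx : x ∈ Ioo (-1 : ℝ) 1) : 0 < jacobiWeight α β x :=
  mul_pos (Real.rpow_pos_of_pos (by linarith [hx.2]) _) (Real.rpow_pos_of_pos (by linarith [hx.1]) _)

theorem jacobiCoeff_pos {x : ℝ} (hx : x ∈ Ioo (-1 : ℝ) 1) : 0 < jacobiCoeff α β x :=
  mul_pos (Real.rpow_pos_of_pos (by linarith [hx.2]) _) (Real.rpow_pos_of_pos (by linarith [hx.1]) _)

theorem contDiffOn_jacobiCoeff {n : ℕ∞} : ContDiffOn ℝ n (jacobiCoeff α β) (Ioo (-1) 1) := by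
  unfold jacobiCoeff
  refine ContDiffOn.mul (ContDiffOn.rpow_const_of_ne (by fun_prop) ?_)
    (ContDiffOn.rpow_const_of_ne (by fun_prop) ?_) <;> intro x hx <;>
  linarith [hx.1, hx.2]

theorem continuousOn_jacobiWeight : ContinuousOn (jacobiWeight α β) (Ioo (-1) 1) := by
  unfold jacobiWeight
  refine ContinuousOn.mul (ContinuousOn.rpow_const (by fun_prop) ?_)
    (ContinuousOn.rpow_const (by fun_prop) ?_) <;> intro x hx <;> left <;>
  linarith [hx.1, hx.2]

theorem measurable_jacobiWeight : Measurable (jacobiWeight α β) := by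
  unfold jacobiWeight
  fun_prop

theorem jacobiWeight_le (hα : 0 ≤ α) (hβ : 0 ≤ β) {x : ℝ} (hx : x ∈ Ioo (-1 : ℝ) 1) :
    jacobiWeight α β x ≤ 2 ^ α * 2 ^ β := by
  unfold jacobiWeight
  have h1 : (0 : ℝ) ≤ 1 - x := by linarith [hx.2]
  have h2 : (0 : ℝ) ≤ 1 + x := by linarith [hx.1]
  gcongr
  · linarith [hx.1]
  · linarith [hx.2]

theorem integrable_jacobiMeasure_iff {F : ℝ → ℂ} : Integrable F (jacobiMeasure α β) ↔
    IntegrableOn (fun x => jacobiWeight α β x • F x) (Ioo (-1) 1) := by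
  unfold jacobiMeasure
  rw [integrable_withDensity_iff_integrable_smul' measurable_jacobiWeight.ennreal_ofReal (by simp)]
  refine integrable_congr ?_
  filter_upwards [ae_restrict_mem measurableSet_Ioo] with x hx
  rw [ENNReal.toReal_ofReal (jacobiWeight_pos hx).le]

theorem integral_jacobiMeasure (F : ℝ → ℂ) : ∫ x, F x ∂jacobiMeasure α β =
    ∫ x in (-1 : ℝ)..1, jacobiWeight α β x • F x := by
  unfold jacobiMeasure
  rw [integral_withDensity_eq_integral_toReal_smul measurable_jacobiWeight.ennreal_ofReal
    (by simp), intervalIntegral.integral_of_le (by norm_num), integral_Ioc_eq_integral_Ioo]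
  refine integral_congr_ae ?_
  filter_upwards [ae_restrict_mem measurableSet_Ioo] with x hx
  rw [ENNReal.toReal_ofReal (jacobiWeight_pos hx).le]

theorem ae_of_ae_jacobiMeasure {P : ℝ → Prop} (h : ∀ᵐ x ∂jacobiMeasure α β, P x) :
    ∀ᵐ x, x ∈ Ioo (-1 : ℝ) 1 → P x := by
  unfold jacobiMeasure at h
  rw [ae_withDensity_iff measurable_jacobiWeight.ennreal_ofReal,
    ae_restrict_iff' measurableSet_Ioo] at h
  filter_upwards [h] with x hx hI
  exact hx hI (by simpa using jacobiWeight_pos hI)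

theorem ae_jacobiMeasure_mem : ∀ᵐ x ∂jacobiMeasure α β, x ∈ Ioo (-1 : ℝ) 1 :=
  ae_jacobiMeasure_of_ae (Eventually.of_forall fun _ h => h)

theorem jacobiMeasure_le (hα : 0 ≤ α) (hβ : 0 ≤ β) : jacobiMeasure α β ≤
    ENNReal.ofReal (2 ^ α * 2 ^ β) • volume.restrict (Ioo (-1) 1) := by
  unfold jacobiMeasure
  rw [← withDensity_const]
  refine withDensity_mono ?_
  filter_upwards [ae_restrict_mem measurableSet_Ioo] with x hx
  exact ENNReal.ofReal_le_ofReal (jacobiWeight_le hα hβ hx)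

/-- Finiteness puts the constants in L² and makes square integrable functions integrable. -/
theorem isFiniteMeasure_jacobiMeasure (hα : 0 ≤ α) (hβ : 0 ≤ β) :
    IsFiniteMeasure (jacobiMeasure α β) := by
  refine ⟨(jacobiMeasure_le hα hβ univ).trans_lt ?_⟩
  simp [ENNReal.mul_lt_top]

/-- A square integrable majorant of all functions in the maximal domain. -/
def jacobiMajorant (α β x : ℝ) : ℝ := (1 + x) ^ (-β) + (1 - x) ^ (-α)

/-- The weight turns the square (1 + x)^(-2β) into a bounded multiple of (1 + x)^(-β), which is
integrable at -1 because β < 1; likewise at 1 with α < 1. -/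
theorem memLp_jacobiMajorant (hα₀ : 0 < α) (hα₁ : α < 1) (hβ₀ : 0 < β) (hβ₁ : β < 1) :
    MemLp (jacobiMajorant α β) 2 (jacobiMeasure α β) := by
  have hl : MemLp (fun x : ℝ => (1 + x) ^ (-β)) 2 (jacobiMeasure α β) := by
    rw [memLp_two_iff_integrable_sq
      (Measurable.aestronglyMeasurable (Measurable.pow_const (by fun_prop) _))]
    suffices h : Integrable (fun x : ℝ => ((((1 + x) ^ (-β)) ^ 2 : ℝ) : ℂ)) (jacobiMeasure α β) from
      h.re
    rw [integrable_jacobiMeasure_iff]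
    have h0 : IntervalIntegrable (fun x : ℝ => (1 + x) ^ (-β)) volume (-1) 1 := by
      have := (intervalIntegral.intervalIntegrable_rpow' (r := -β) (by linarith)
        (a := 0) (b := 2)).comp_add_left 1
      norm_num at this
      exact this
    rw [intervalIntegrable_iff_integrableOn_Ioo_of_le (by norm_num)] at h0
    refine (h0.const_mul (2 ^ α)).mono' ?_ ?_
    · exact (measurable_jacobiWeight.smul (by fun_prop)).aestronglyMeasurable
    · filter_upwards [ae_restrict_mem measurableSet_Ioo] with x hx
      have h2 : (0 : ℝ) < 1 + x := by linarith [hx.1]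
      have h1 : (0 : ℝ) ≤ 1 - x := by linarith [hx.2]
      have e : (1 + x) ^ β * ((1 + x) ^ (-β)) ^ 2 = (1 + x) ^ (-β) := by
        rw [pow_two, ← mul_assoc, ← Real.rpow_add h2]; simp
      rw [norm_smul, Complex.norm_real, Real.norm_of_nonneg (jacobiWeight_pos hx).le,
        Real.norm_of_nonneg (by positivity), jacobiWeight, mul_assoc, e]
      gcongr
      linarith [hx.1]
  have hr : MemLp (fun x : ℝ => (1 - x) ^ (-α)) 2 (jacobiMeasure α β) := by
    rw [memLp_two_iff_integrable_sq
      (Measurable.aestronglyMeasurable (Measurable.pow_const (by fun_prop) _))]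
    suffices h : Integrable (fun x : ℝ => ((((1 - x) ^ (-α)) ^ 2 : ℝ) : ℂ)) (jacobiMeasure α β) from
      h.re
    rw [integrable_jacobiMeasure_iff]
    have h0 : IntervalIntegrable (fun x : ℝ => (1 - x) ^ (-α)) volume (-1) 1 := by
      have := (intervalIntegral.intervalIntegrable_rpow' (r := -α) (by linarith)
        (a := 0) (b := 2)).comp_sub_left 1
      norm_num at this
      exact this.symm
    rw [intervalIntegrable_iff_integrableOn_Ioo_of_le (by norm_num)] at h0
    refine (h0.const_mul (2 ^ β)).mono' ?_ ?_
    · exact (measurable_jacobiWeight.smul (by fun_prop)).aestronglyMeasurable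
    · filter_upwards [ae_restrict_mem measurableSet_Ioo] with x hx
      have h2 : (0 : ℝ) ≤ 1 + x := by linarith [hx.1]
      have h1 : (0 : ℝ) < 1 - x := by linarith [hx.2]
      have e : (1 - x) ^ α * ((1 - x) ^ (-α)) ^ 2 = (1 - x) ^ (-α) := by
        rw [pow_two, ← mul_assoc, ← Real.rpow_add h1]; simp
      rw [norm_smul, Complex.norm_real, Real.norm_of_nonneg (jacobiWeight_pos hx).le,
        Real.norm_of_nonneg (by positivity), jacobiWeight, mul_comm ((1 - x) ^ α), mul_assoc, e]
      gcongr
      linarith [hx.2]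
  exact hl.add hr

theorem jacobiMajorant_pos {x : ℝ} (hx : x ∈ Ioo (-1 : ℝ) 1) : 0 < jacobiMajorant α β x :=
  add_pos (Real.rpow_pos_of_pos (by linarith [hx.1]) _) (Real.rpow_pos_of_pos (by linarith [hx.2]) _)

theorem aestronglyMeasurable_jacobiMeasure {F : ℝ → ℂ} (hF : ContinuousOn F (Ioo (-1) 1)) :
    AEStronglyMeasurable F (jacobiMeasure α β) :=
  (hF.aestronglyMeasurable measurableSet_Ioo).mono_ac (withDensity_absolutelyContinuous _ _)

theorem memLp_of_norm_le_jacobiMajorant (hα₀ : 0 < α) (hα₁ : α < 1) (hβ₀ : 0 < β) (hβ₁ : β < 1)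
    {F : ℝ → ℂ} (hF : ContinuousOn F (Ioo (-1) 1)) (C : ℝ)
    (h : ∀ x ∈ Ioo (-1 : ℝ) 1, ‖F x‖ ≤ C * jacobiMajorant α β x) :
    MemLp F 2 (jacobiMeasure α β) := by
  refine (memLp_jacobiMajorant hα₀ hα₁ hβ₀ hβ₁).of_le_mul (c := C)
    (aestronglyMeasurable_jacobiMeasure hF) ?_
  filter_upwards [ae_jacobiMeasure_mem] with x hx
  rw [Real.norm_of_nonneg (jacobiMajorant_pos hx).le]
  exact h x hx

theorem intervalIntegrable_weight_smul {F : ℝ → ℂ} (h : Integrable F (jacobiMeasure α β)) :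
    IntervalIntegrable (fun x => jacobiWeight α β x • F x) volume (-1) 1 := by
  rw [intervalIntegrable_iff_integrableOn_Ioo_of_le (by norm_num)]
  exact integrable_jacobiMeasure_iff.1 h

end Weight

/-! ### Local absolute continuity on open intervals. -/

theorem ACLocOn.continuousOn {f : ℝ → ℂ} {a b : ℝ} (hf : ACLocOn f a b) :
    ContinuousOn f (Ioo a b) := by
  intro x hx
  obtain ⟨c, hac, hcx⟩ := exists_between hx.1
  obtain ⟨d, hxd, hdb⟩ := exists_between hx.2
  have h := (hf c ⟨hac, hcx.trans hx.2⟩ d ⟨hx.1.trans hxd, hdb⟩).continuousOn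
  refine (h.continuousAt ?_).continuousWithinAt
  rw [uIcc_of_le (hcx.trans hxd).le]
  exact Icc_mem_nhds hcx hxd

theorem acLocOn_of_contDiffOn {f : ℝ → ℂ} {a b : ℝ} (hf : ContDiffOn ℝ 1 f (Ioo a b)) :
    ACLocOn f a b := fun _ hc _ hd =>
  (hf.mono (ordConnected_Ioo.uIcc_subset hc hd)).absolutelyContinuousOnInterval

theorem acOn_jacobiCoeff {α β c d : ℝ} (hc : c ∈ Ioo (-1 : ℝ) 1) (hd : d ∈ Ioo (-1 : ℝ) 1) :
    AbsolutelyContinuousOnInterval (jacobiCoeff α β) c d :=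
  ((contDiffOn_jacobiCoeff (n := 1)).mono
    (ordConnected_Ioo.uIcc_subset hc hd)).absolutelyContinuousOnInterval

/-! ### Lagrange's identity and Green's formula. -/

section Green

variable {α β : ℝ} {f g : ℝ → ℂ}

theorem ae_hasDerivAt_coeff_smul_deriv (hf : InJacobiMax α β f) :
    ∀ᵐ x, x ∈ Ioo (-1 : ℝ) 1 → HasDerivAt (fun t => jacobiCoeff α β t • deriv f t)
      (-(jacobiWeight α β x • jacobiExpr α β f x)) x := by
  filter_upwards [hf.ae_differentiableAt] with x h hx
  have e : -(jacobiWeight α β x • jacobiExpr α β f x) =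
      deriv (fun t => jacobiCoeff α β t • deriv f t) x := by
    simp only [jacobiExpr]
    rw [smul_neg, neg_neg, smul_inv_smul₀ (jacobiWeight_pos hx).ne']
  rw [e]
  exact (h hx).hasDerivAt

theorem jacobiForm_eq (f g : ℝ → ℂ) (x : ℝ) : jacobiForm α β f g x =
    f x * conj (jacobiCoeff α β x • deriv g x) - (jacobiCoeff α β x • deriv f x) * conj (g x) := by
  simp only [jacobiForm, Complex.real_smul, map_mul, Complex.conj_ofReal]
  ring

/-- By the product rule, where the terms f' conj (p g') and p f' conj g' cancel because p is real.
-/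
theorem ae_hasDerivAt_jacobiForm (hf : InJacobiMax α β f) (hg : InJacobiMax α β g) :
    ∀ᵐ x, x ∈ Ioo (-1 : ℝ) 1 → HasDerivAt (jacobiForm α β f g) (jacobiWeight α β x •
      (jacobiExpr α β f x * conj (g x) - f x * conj (jacobiExpr α β g x))) x := by
  filter_upwards [ae_hasDerivAt_coeff_smul_deriv hf, ae_hasDerivAt_coeff_smul_deriv hg]
    with x hf' hg' hx
  have h1 := (hf.differentiableAt x hx).hasDerivAt
  have h2 := (hg.differentiableAt x hx).hasDerivAt
  have h := (h1.mul (hg' hx).star).sub ((hf' hx).mul h2.star)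
  have e : jacobiForm α β f g = _ := funext (jacobiForm_eq f g)
  rw [e]
  refine h.congr_deriv ?_
  simp only [Complex.real_smul, Complex.star_def, map_neg, map_mul, Complex.conj_ofReal]
  ring

theorem acOn_jacobiForm (hf : InJacobiMax α β f) (hg : InJacobiMax α β g) {c d : ℝ}
    (hc : c ∈ Ioo (-1 : ℝ) 1) (hd : d ∈ Ioo (-1 : ℝ) 1) :
    AbsolutelyContinuousOnInterval (jacobiForm α β f g) c d :=
  (acOn_jacobiCoeff hc hd).smul (((hf.acLoc c hc d hd).smul (hg.acLoc_deriv c hc d hd).star).sub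
    ((hf.acLoc_deriv c hc d hd).smul (hg.acLoc c hc d hd).star))

theorem MeasureTheory.MemLp.integrable_mul_conj {μ : Measure ℝ} (hf : MemLp f 2 μ)
    (hg : MemLp g 2 μ) : Integrable (fun x => f x * conj (g x)) μ :=
  hf.integrable_mul hg.star

theorem integrable_green (hf : InJacobiMax α β f) (hg : InJacobiMax α β g) :
    Integrable (fun x => jacobiExpr α β f x * conj (g x) - f x * conj (jacobiExpr α β g x))
      (jacobiMeasure α β) :=
  (hf.memLp_expr.integrable_mul_conj hg.memLp).sub (hf.memLp.integrable_mul_conj hg.memLp_expr)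

/-- **Green's formula** for the Jacobi expression. -/
theorem exists_tendsto_jacobiForm (hf : InJacobiMax α β f) (hg : InJacobiMax α β g) :
    ∃ a b : ℂ, Tendsto (jacobiForm α β f g) (𝓝[>] (-1)) (𝓝 a) ∧
      Tendsto (jacobiForm α β f g) (𝓝[<] 1) (𝓝 b) ∧
      ∫ x, jacobiExpr α β f x * conj (g x) - f x * conj (jacobiExpr α β g x)
        ∂jacobiMeasure α β = b - a := by
  set G : ℝ → ℂ := fun x => jacobiWeight α β x •
    (jacobiExpr α β f x * conj (g x) - f x * conj (jacobiExpr α β g x))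
  have hG : IntervalIntegrable G volume (-1) 1 :=
    intervalIntegrable_weight_smul (integrable_green hf hg)
  have h0 : (0 : ℝ) ∈ Ioo (-1 : ℝ) 1 := by norm_num
  have h0' : (0 : ℝ) ∈ uIcc (-1 : ℝ) 1 := by rw [uIcc_of_le] <;> norm_num
  -- The form is a primitive of G, and G is integrable up to both endpoints, so it extends
  -- continuously to [-1, 1].
  have hI : ∀ x ∈ Ioo (-1 : ℝ) 1,
      jacobiForm α β f g 0 + ∫ t in (0 : ℝ)..x, G t = jacobiForm α β f g x := by
    intro x hx
    have hsub := ordConnected_Ioo.uIcc_subset h0 hx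
    rw [(acOn_jacobiForm hf hg h0 hx).integral_eq_sub_of_ae_hasDerivAt
      (hG.mono_set ((hsub.trans Ioo_subset_Icc_self).trans Icc_subset_uIcc)) ?_]
    · ring
    · filter_upwards [ae_hasDerivAt_jacobiForm hf hg] with t ht h using ht (hsub h)
  have hcont : ContinuousOn (fun x => jacobiForm α β f g 0 + ∫ t in (0 : ℝ)..x, G t)
      (uIcc (-1) 1) :=
    continuousOn_const.add
      (AbsolutelyContinuousOnInterval.intervalIntegral_complex hG h0').continuousOn
  have hl := (hcont (-1) left_mem_uIcc).mono_left (y := 𝓝[>] (-1)) (by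
    rw [uIcc_of_le (by norm_num), ← nhdsWithin_Ioo_eq_nhdsGT (by norm_num : (-1 : ℝ) < 1)]
    exact nhdsWithin_mono _ Ioo_subset_Icc_self)
  have hr := (hcont 1 right_mem_uIcc).mono_left (y := 𝓝[<] 1) (by
    rw [uIcc_of_le (by norm_num), ← nhdsWithin_Ioo_eq_nhdsLT (by norm_num : (-1 : ℝ) < 1)]
    exact nhdsWithin_mono _ Ioo_subset_Icc_self)
  refine ⟨_, _, hl.congr' ?_, hr.congr' ?_, ?_⟩
  · filter_upwards [Ioo_mem_nhdsGT (by norm_num : (-1 : ℝ) < 1)] with x hx using hI x hx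
  · filter_upwards [Ioo_mem_nhdsLT (by norm_num : (-1 : ℝ) < 1)] with x hx using hI x hx
  · rw [integral_jacobiMeasure, add_sub_add_left_eq_sub, intervalIntegral.integral_symm (-1) 0,
      sub_neg_eq_add, add_comm, intervalIntegral.integral_add_adjacent_intervals]
    · exact hG.mono_set (uIcc_subset_uIcc left_mem_uIcc h0')
    · exact hG.mono_set (uIcc_subset_uIcc h0' right_mem_uIcc)

end Green

/-! ### Solving ℓ[f] = F in the maximal domain. -/

/-- Comparison with (C / γ) (1 - t)^(-γ), whose derivative is the bound for f' and whose value at 0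
is nonnegative. -/
theorem norm_le_of_norm_deriv_le_rpow {f f' : ℝ → ℂ} {γ C : ℝ} (hγ : 0 < γ) (hC : 0 ≤ C)
    (hf : ∀ t ∈ Ico (0 : ℝ) 1, HasDerivAt f (f' t) t) (h0 : f 0 = 0)
    (hf' : ∀ t ∈ Ico (0 : ℝ) 1, ‖f' t‖ ≤ C * (1 - t) ^ (-γ - 1)) {x : ℝ} (hx : x ∈ Ico (0 : ℝ) 1) :
    ‖f x‖ ≤ C / γ * (1 - x) ^ (-γ) := by
  have hsub : ∀ t ∈ Icc (0 : ℝ) x, t ∈ Ico (0 : ℝ) 1 := fun t ht => ⟨ht.1, ht.2.trans_lt hx.2⟩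
  have hB : ∀ t ∈ Ico (0 : ℝ) 1,
      HasDerivAt (fun t : ℝ => C / γ * (1 - t) ^ (-γ)) (C * (1 - t) ^ (-γ - 1)) t := by
    intro t ht
    have h1 : HasDerivAt (fun t : ℝ => 1 - t) (-1) t := (hasDerivAt_id t).const_sub 1
    refine ((h1.rpow_const (p := -γ) (Or.inl (by linarith [ht.2]))).const_mul (C / γ)).congr_deriv ?_
    field_simp
  refine image_norm_le_of_norm_deriv_right_le_deriv_boundary' (a := 0) (b := x)
    (B' := fun t => C * (1 - t) ^ (-γ - 1))
    (fun t ht => (hf t (hsub t ht)).continuousAt.continuousWithinAt)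
    (fun t ht => (hf t (hsub t (Ico_subset_Icc_self ht))).hasDerivWithinAt) ?_
    (fun t ht => (hB t (hsub t ht)).continuousAt.continuousWithinAt)
    (fun t ht => (hB t (hsub t (Ico_subset_Icc_self ht))).hasDerivWithinAt)
    (fun t ht => hf' t (hsub t (Ico_subset_Icc_self ht))) ⟨hx.1, le_rfl⟩
  rw [h0, norm_zero]
  simp only [sub_zero, Real.one_rpow]
  positivity

/-- A quasi-derivative `p f'` of a solution of `ℓ[f] = F`, up to sign. -/
def jacobiPrimitive (α β : ℝ) (c : ℂ) (F : ℝ → ℂ) (x : ℝ) : ℂ :=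
  c + ∫ t in (0 : ℝ)..x, jacobiWeight α β t • F t

/-- The solution of `ℓ[f] = F` with `f(0) = 0` and `(pf')(0) = -c`. -/
def jacobiSolution (α β : ℝ) (c : ℂ) (F : ℝ → ℂ) (x : ℝ) : ℂ :=
  ∫ t in (0 : ℝ)..x, -((jacobiCoeff α β t)⁻¹ • jacobiPrimitive α β c F t)

section Solution

variable {α β : ℝ} {F : ℝ → ℂ}

theorem acOn_jacobiPrimitive (c : ℂ) (hF : Integrable F (jacobiMeasure α β)) :
    AbsolutelyContinuousOnInterval (jacobiPrimitive α β c F) (-1) 1 :=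
  (AbsolutelyContinuousOnInterval.const c (-1) 1).add
    (AbsolutelyContinuousOnInterval.intervalIntegral_complex (intervalIntegrable_weight_smul hF)
      (by rw [uIcc_of_le] <;> norm_num))

theorem ae_hasDerivAt_jacobiPrimitive (c : ℂ) (hF : Integrable F (jacobiMeasure α β)) :
    ∀ᵐ x, x ∈ Ioo (-1 : ℝ) 1 →
      HasDerivAt (jacobiPrimitive α β c F) (jacobiWeight α β x • F x) x := by
  filter_upwards [(intervalIntegrable_weight_smul hF).ae_hasDerivAt_integral] with x h hx
  exact (h (Icc_subset_uIcc (Ioo_subset_Icc_self hx)) 0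
    (by rw [uIcc_of_le] <;> norm_num)).const_add c

theorem acLocOn_coeff_inv_smul_primitive (c : ℂ) (hF : Integrable F (jacobiMeasure α β)) :
    ACLocOn (fun t => -((jacobiCoeff α β t)⁻¹ • jacobiPrimitive α β c F t)) (-1) 1 := by
  intro a ha b hb
  have hsub := ordConnected_Ioo.uIcc_subset ha hb
  have h1 : AbsolutelyContinuousOnInterval (fun t => (jacobiCoeff α β t)⁻¹) a b :=
    ContDiffOn.absolutelyContinuousOnInterval
      (((contDiffOn_jacobiCoeff (n := 1)).mono hsub).inv fun x hx => (jacobiCoeff_pos (hsub hx)).ne')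
  exact (h1.smul ((acOn_jacobiPrimitive c hF).mono
    ((hsub.trans Ioo_subset_Icc_self).trans Icc_subset_uIcc))).neg

/-- The integrand is continuous, so the derivative exists at every point and not only almost
everywhere. -/
theorem hasDerivAt_jacobiSolution (c : ℂ) (hF : Integrable F (jacobiMeasure α β)) {x : ℝ}
    (hx : x ∈ Ioo (-1 : ℝ) 1) : HasDerivAt (jacobiSolution α β c F)
      (-((jacobiCoeff α β x)⁻¹ • jacobiPrimitive α β c F x)) x := by
  have hcont := (acLocOn_coeff_inv_smul_primitive c hF).continuousOn
  have h0 : (0 : ℝ) ∈ Ioo (-1 : ℝ) 1 := by norm_num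
  exact intervalIntegral.integral_hasDerivAt_right
    ((hcont.mono (ordConnected_Ioo.uIcc_subset h0 hx)).intervalIntegrable)
    (hcont.stronglyMeasurableAtFilter isOpen_Ioo x hx)
    (hcont.continuousAt (isOpen_Ioo.mem_nhds hx))

/-- The quasi-derivative is continuous on [-1, 1], hence bounded by some K. So f' is at most K / p,
whose integral grows no faster than the majorant. -/
theorem norm_jacobiSolution_le (hα : 0 < α) (hβ : 0 < β) (c : ℂ)
    (hF : Integrable F (jacobiMeasure α β)) :
    ∃ C, ∀ x ∈ Ioo (-1 : ℝ) 1, ‖jacobiSolution α β c F x‖ ≤ C * jacobiMajorant α β x := by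
  obtain ⟨K, hK⟩ := (acOn_jacobiPrimitive c hF).exists_bound
  have hK0 : 0 ≤ K := (norm_nonneg _).trans (hK 1 right_mem_uIcc)
  have hbd : ∀ t ∈ Ioo (-1 : ℝ) 1, ‖-((jacobiCoeff α β t)⁻¹ • jacobiPrimitive α β c F t)‖ ≤
      K * ((1 - t) ^ (-α - 1) * (1 + t) ^ (-β - 1)) := by
    intro t ht
    have h1 : (0 : ℝ) ≤ 1 - t := by linarith [ht.2]
    have h2 : (0 : ℝ) ≤ 1 + t := by linarith [ht.1]
    rw [norm_neg, norm_smul, norm_inv, Real.norm_of_nonneg (jacobiCoeff_pos ht).le, mul_comm,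
      jacobiCoeff, mul_inv, ← Real.rpow_neg h1, ← Real.rpow_neg h2, neg_add', neg_add']
    have := hK t (Icc_subset_uIcc (Ioo_subset_Icc_self ht))
    gcongr
  have hzero : jacobiSolution α β c F 0 = 0 := intervalIntegral.integral_same
  refine ⟨K / α + K / β, fun x hx => ?_⟩
  have p1 : (0 : ℝ) ≤ (1 + x) ^ (-β) := Real.rpow_nonneg (by linarith [hx.1]) _
  have p2 : (0 : ℝ) ≤ (1 - x) ^ (-α) := Real.rpow_nonneg (by linarith [hx.2]) _
  have p3 : 0 ≤ K / α := by positivity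
  have p4 : 0 ≤ K / β := by positivity
  rw [jacobiMajorant]
  rcases le_total 0 x with h | h
  -- On the right half the factor of 1 / p that is singular at -1 is at most 1; the left half
  -- follows by t ↦ -t.
  · have := norm_le_of_norm_deriv_le_rpow (γ := α) (C := K) hα hK0
      (fun t ht => hasDerivAt_jacobiSolution c hF ⟨by linarith [ht.1], ht.2⟩) hzero
      (fun t ht => (hbd t ⟨by linarith [ht.1], ht.2⟩).trans (by
        have h1 : (0 : ℝ) ≤ 1 - t := by linarith [ht.2]
        have : (1 + t) ^ (-β - 1) ≤ 1 :=
          Real.rpow_le_one_of_one_le_of_nonpos (by linarith [ht.1]) (by linarith)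
        gcongr
        exact mul_le_of_le_one_right (by positivity) this)) ⟨h, hx.2⟩
    nlinarith [mul_nonneg p3 p1, mul_nonneg p4 p1, mul_nonneg p4 p2]
  · have := norm_le_of_norm_deriv_le_rpow (γ := β) (C := K) (x := -x)
      (f := fun t => jacobiSolution α β c F (-t)) hβ hK0
      (fun t ht => (hasDerivAt_jacobiSolution c hF
        ⟨by linarith [ht.2], by linarith [ht.1]⟩).scomp t (hasDerivAt_neg t)) (by simpa using hzero)
      (fun t ht => by
        rw [norm_smul, norm_neg, norm_one, one_mul]
        refine (hbd (-t) ⟨by linarith [ht.2], by linarith [ht.1]⟩).trans ?_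
        have h1 : (0 : ℝ) ≤ 1 - t := by linarith [ht.2]
        have : (1 - -t) ^ (-α - 1) ≤ 1 :=
          Real.rpow_le_one_of_one_le_of_nonpos (by linarith [ht.1]) (by linarith)
        rw [← sub_eq_add_neg]
        gcongr
        exact mul_le_of_le_one_left (by positivity) this) ⟨by linarith, by linarith [hx.1]⟩
    simp only [neg_neg, sub_neg_eq_add] at this
    nlinarith [mul_nonneg p3 p1, mul_nonneg p3 p2, mul_nonneg p4 p2]

theorem coeff_smul_deriv_jacobiSolution (c : ℂ) (hF : Integrable F (jacobiMeasure α β)) {x : ℝ}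
    (hx : x ∈ Ioo (-1 : ℝ) 1) : jacobiCoeff α β x • deriv (jacobiSolution α β c F) x =
      -jacobiPrimitive α β c F x := by
  rw [(hasDerivAt_jacobiSolution c hF hx).deriv, smul_neg, smul_inv_smul₀ (jacobiCoeff_pos hx).ne']

theorem jacobiExpr_jacobiSolution (c : ℂ) (hF : Integrable F (jacobiMeasure α β)) :
    jacobiExpr α β (jacobiSolution α β c F) =ᵐ[jacobiMeasure α β] F := by
  refine ae_jacobiMeasure_of_ae ?_
  filter_upwards [ae_hasDerivAt_jacobiPrimitive c hF] with x h hx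
  have e : (fun t => jacobiCoeff α β t • deriv (jacobiSolution α β c F) t) =ᶠ[𝓝 x]
      fun t => -jacobiPrimitive α β c F t := by
    filter_upwards [isOpen_Ioo.mem_nhds hx] with t ht using coeff_smul_deriv_jacobiSolution c hF ht
  simp only [jacobiExpr]
  rw [e.deriv_eq, (h hx).fun_neg.deriv, smul_neg, neg_neg, inv_smul_smul₀ (jacobiWeight_pos hx).ne']

theorem inJacobiMax_jacobiSolution (hα₀ : 0 < α) (hα₁ : α < 1) (hβ₀ : 0 < β) (hβ₁ : β < 1)
    (c : ℂ) (hF : MemLp F 2 (jacobiMeasure α β)) : InJacobiMax α β (jacobiSolution α β c F) := by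
  have := isFiniteMeasure_jacobiMeasure hα₀.le hβ₀.le
  have hF1 : Integrable F (jacobiMeasure α β) := hF.integrable (by norm_num)
  have hd : ∀ x ∈ Ioo (-1 : ℝ) 1, DifferentiableAt ℝ (jacobiSolution α β c F) x :=
    fun x hx => (hasDerivAt_jacobiSolution c hF1 hx).differentiableAt
  have hderiv : EqOn (fun t => -((jacobiCoeff α β t)⁻¹ • jacobiPrimitive α β c F t))
      (deriv (jacobiSolution α β c F)) (Ioo (-1) 1) :=
    fun x hx => (hasDerivAt_jacobiSolution c hF1 hx).deriv.symm
  have hcont := (acLocOn_coeff_inv_smul_primitive c hF1).continuousOn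
  obtain ⟨C, hC⟩ := norm_jacobiSolution_le hα₀ hβ₀ c hF1
  refine ⟨hd, ?_, (acLocOn_coeff_inv_smul_primitive c hF1).congr hderiv, ?_, ?_⟩
  · refine acLocOn_of_contDiffOn ((contDiffOn_one_iff_derivWithin isOpen_Ioo.uniqueDiffOn).2
      ⟨fun x hx => (hd x hx).differentiableWithinAt, hcont.congr fun x hx => ?_⟩)
    rw [derivWithin_of_isOpen isOpen_Ioo hx]
    exact (hderiv hx).symm
  · exact memLp_of_norm_le_jacobiMajorant hα₀ hα₁ hβ₀ hβ₁
      (fun x hx => (hd x hx).continuousAt.continuousWithinAt) C hC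
  · exact hF.ae_eq (jacobiExpr_jacobiSolution c hF1).symm

/-- The solution `x ↦ ∫₀ˣ 1/p` of `ℓ[f] = 0`. -/
def jacobiSecond (α β : ℝ) : ℝ → ℂ := jacobiSolution α β (-1) 0

theorem inJacobiMax_jacobiSecond (hα₀ : 0 < α) (hα₁ : α < 1) (hβ₀ : 0 < β) (hβ₁ : β < 1) :
    InJacobiMax α β (jacobiSecond α β) :=
  inJacobiMax_jacobiSolution hα₀ hα₁ hβ₀ hβ₁ _ MemLp.zero

theorem coeff_smul_deriv_jacobiSecond {x : ℝ} (hx : x ∈ Ioo (-1 : ℝ) 1) :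
    jacobiCoeff α β x • deriv (jacobiSecond α β) x = 1 := by
  rw [jacobiSecond, coeff_smul_deriv_jacobiSolution _ (integrable_zero _ _ _) hx]
  simp [jacobiPrimitive]

theorem jacobiExpr_jacobiSecond : jacobiExpr α β (jacobiSecond α β) =ᵐ[jacobiMeasure α β] 0 :=
  jacobiExpr_jacobiSolution _ (integrable_zero _ _ _)

theorem conj_jacobiSecond (x : ℝ) : conj (jacobiSecond α β x) = jacobiSecond α β x := by
  have h : jacobiSecond α β x = ((∫ t in (0 : ℝ)..x, (jacobiCoeff α β t)⁻¹ : ℝ) : ℂ) := by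
    rw [← intervalIntegral.integral_ofReal]
    simp [jacobiSecond, jacobiSolution, jacobiPrimitive]
  rw [h, Complex.conj_ofReal]

theorem jacobiExpr_const (c : ℂ) : jacobiExpr α β (fun _ => c) = 0 := by
  ext x
  simp [jacobiExpr]

theorem inJacobiMax_const (hα : 0 < α) (hβ : 0 < β) (c : ℂ) : InJacobiMax α β (fun _ => c) := by
  have := isFiniteMeasure_jacobiMeasure hα.le hβ.le
  refine ⟨fun x _ => differentiableAt_const _, fun a _ b _ => .const c a b, ?_, memLp_const c, ?_⟩
  · have h : deriv (fun _ : ℝ => c) = fun _ => 0 := by ext; simp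
    rw [h]
    exact fun a _ b _ => .const 0 a b
  · rw [jacobiExpr_const]
    exact MemLp.zero

end Solution

/-! ### Algebra of the form against the solutions 1 and q. -/

section Form

variable {α β : ℝ} {f g h : ℝ → ℂ}

theorem jacobiForm_add_left (hf : InJacobiMax α β f) (hg : InJacobiMax α β g) (h : ℝ → ℂ) {x : ℝ}
    (hx : x ∈ Ioo (-1 : ℝ) 1) :
    jacobiForm α β (f + g) h x = jacobiForm α β f h x + jacobiForm α β g h x := by
  simp only [jacobiForm, hf.deriv_add_eq hg hx, Pi.add_apply, ← smul_add]
  congr 1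
  ring

theorem jacobiForm_smul_left (c : ℂ) (hf : InJacobiMax α β f) (h : ℝ → ℂ) {x : ℝ}
    (hx : x ∈ Ioo (-1 : ℝ) 1) : jacobiForm α β (c • f) h x = c * jacobiForm α β f h x := by
  simp only [jacobiForm, hf.deriv_smul_eq c hx, Pi.smul_apply, smul_eq_mul, Complex.real_smul]
  ring

theorem jacobiForm_const_one (f : ℝ → ℂ) (x : ℝ) :
    jacobiForm α β f (fun _ => 1) x = -(jacobiCoeff α β x • deriv f x) := by
  simp [jacobiForm]

theorem jacobiForm_jacobiSecond (f : ℝ → ℂ) {x : ℝ} (hx : x ∈ Ioo (-1 : ℝ) 1) :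
    jacobiForm α β f (jacobiSecond α β) x =
      f x - (jacobiCoeff α β x • deriv f x) * jacobiSecond α β x := by
  rw [jacobiForm_eq, coeff_smul_deriv_jacobiSecond hx, conj_jacobiSecond, map_one, mul_one]

/-- A Plücker identity, using [f,1] = -p f' and [f,q] = f - p f' q. Once [f,1] and [f,q] tend to 0
at an endpoint, so does [f,g] for every g in the maximal domain. -/
theorem jacobiForm_eq_of_jacobiSecond (f g : ℝ → ℂ) {x : ℝ} (hx : x ∈ Ioo (-1 : ℝ) 1) :
    jacobiForm α β f g x =
      jacobiForm α β f (fun _ => 1) x * conj (jacobiForm α β g (jacobiSecond α β) x) -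
        jacobiForm α β f (jacobiSecond α β) x * conj (jacobiForm α β g (fun _ => 1) x) := by
  rw [jacobiForm_const_one, jacobiForm_const_one, jacobiForm_jacobiSecond f hx,
    jacobiForm_jacobiSecond g hx, jacobiForm_eq, map_sub, map_mul, conj_jacobiSecond, map_neg]
  ring

theorem eventually_mem_Ioo_right : ∀ᶠ x in 𝓝[>] (-1 : ℝ), x ∈ Ioo (-1 : ℝ) 1 :=
  Ioo_mem_nhdsGT (by norm_num)

theorem eventually_mem_Ioo_left : ∀ᶠ x in 𝓝[<] (1 : ℝ), x ∈ Ioo (-1 : ℝ) 1 :=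
  Ioo_mem_nhdsLT (by norm_num)

end Form

/-! ### The minimal and maximal relations and the adjoint. -/

section Graph

variable {α β : ℝ} {f g : ℝ → ℂ}

theorem MeasureTheory.L2.inner_eq_integral {μ : Measure ℝ} {a b : Lp ℂ 2 μ} (ha : a =ᵐ[μ] f)
    (hb : b =ᵐ[μ] g) : inner ℂ a b = ∫ x, g x * conj (f x) ∂μ := by
  rw [L2.inner_def]
  refine integral_congr_ae ?_
  filter_upwards [ha, hb] with x h1 h2
  rw [h1, h2, RCLike.inner_apply]

theorem inner_sub_inner_eq (hf : InJacobiMax α β f) (hg : InJacobiMax α β g)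
    {y z : JacobiL2 α β × JacobiL2 α β} (hz₁ : z.1 =ᵐ[jacobiMeasure α β] f)
    (hz₂ : z.2 =ᵐ[jacobiMeasure α β] jacobiExpr α β f) (hy₁ : y.1 =ᵐ[jacobiMeasure α β] g)
    (hy₂ : y.2 =ᵐ[jacobiMeasure α β] jacobiExpr α β g) :
    inner ℂ y.1 z.2 - inner ℂ y.2 z.1 =
      ∫ x, jacobiExpr α β f x * conj (g x) - f x * conj (jacobiExpr α β g x)
        ∂jacobiMeasure α β := by
  rw [L2.inner_eq_integral hy₁ hz₂, L2.inner_eq_integral hy₂ hz₁, integral_sub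
    (hf.memLp_expr.integrable_mul_conj hg.memLp) (hf.memLp.integrable_mul_conj hg.memLp_expr)]

theorem toLp_mem_jacobiMax (hf : InJacobiMax α β f) :
    (hf.memLp.toLp f, hf.memLp_expr.toLp _) ∈ jacobiMax α β :=
  ⟨f, hf, hf.memLp.coeFn_toLp, hf.memLp_expr.coeFn_toLp⟩

/-- Green's formula turns the condition on limits into orthogonality in L² × L², a form suited to
adjoints and closedness. -/
theorem mem_jacobiMin_iff (z : JacobiL2 α β × JacobiL2 α β) : z ∈ jacobiMin α β ↔
    z ∈ jacobiMax α β ∧ ∀ y ∈ jacobiMax α β, inner ℂ y.1 z.2 - inner ℂ y.2 z.1 = 0 := by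
  constructor
  · rintro ⟨f, ⟨hf, hfmin⟩, h1, h2⟩
    refine ⟨⟨f, hf, h1, h2⟩, ?_⟩
    rintro y ⟨g, hg, k1, k2⟩
    obtain ⟨a, b, ha, hb, hab⟩ := exists_tendsto_jacobiForm hf hg
    obtain ⟨c, hca, hcb⟩ := hfmin g hg
    rw [inner_sub_inner_eq hf hg h1 h2 k1 k2, hab, tendsto_nhds_unique ha hca,
      tendsto_nhds_unique hb hcb, sub_self]
  · rintro ⟨⟨f, hf, h1, h2⟩, h⟩
    refine ⟨f, ⟨hf, fun g hg => ?_⟩, h1, h2⟩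
    obtain ⟨a, b, ha, hb, hab⟩ := exists_tendsto_jacobiForm hf hg
    have := h _ (toLp_mem_jacobiMax hg)
    rw [inner_sub_inner_eq (y := (hg.memLp.toLp g, hg.memLp_expr.toLp _)) hf hg h1 h2
      hg.memLp.coeFn_toLp hg.memLp_expr.coeFn_toLp, hab, sub_eq_zero] at this
    exact ⟨a, ha, this ▸ hb⟩

theorem jacobiMin_le_jacobiMax : jacobiMin α β ≤ jacobiMax α β :=
  fun z hz => ((mem_jacobiMin_iff z).1 hz).1

theorem jacobiMax_le_adjoint : jacobiMax α β ≤ (jacobiMin α β).adjoint := by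
  intro x hx
  rw [Submodule.mem_adjoint_iff]
  intro a b hab
  -- The adjoint condition is the complex conjugate of the vanishing of Green's form.
  have := congrArg conj (((mem_jacobiMin_iff (a, b)).1 hab).2 x hx)
  rw [map_sub, inner_conj_symm, inner_conj_symm, map_zero] at this
  exact this

theorem exists_mem_jacobiDMin (hα₀ : 0 < α) (hα₁ : α < 1) (hβ₀ : 0 < β) (hβ₁ : β < 1)
    {F : ℝ → ℂ} (hF : MemLp F 2 (jacobiMeasure α β)) (h1 : ∫ x, F x ∂jacobiMeasure α β = 0)
    (hq : ∫ x, F x * conj (jacobiSecond α β x) ∂jacobiMeasure α β = 0) :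
    ∃ f ∈ jacobiDMin α β, jacobiExpr α β f =ᵐ[jacobiMeasure α β] F := by
  have := isFiniteMeasure_jacobiMeasure hα₀.le hβ₀.le
  have hF1 : Integrable F (jacobiMeasure α β) := hF.integrable (by norm_num)
  set f₀ := jacobiSolution α β 0 F with hf₀_def
  have hf₀ : InJacobiMax α β f₀ := inJacobiMax_jacobiSolution hα₀ hα₁ hβ₀ hβ₁ 0 hF
  have hℓ : jacobiExpr α β f₀ =ᵐ[jacobiMeasure α β] F := jacobiExpr_jacobiSolution 0 hF1
  have h1max : InJacobiMax α β (fun _ => (1 : ℂ)) := inJacobiMax_const hα₀ hβ₀ 1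
  have hqmax := inJacobiMax_jacobiSecond hα₀ hα₁ hβ₀ hβ₁
  obtain ⟨a₁, b₁, l₁, r₁, e₁⟩ := exists_tendsto_jacobiForm hf₀ h1max
  obtain ⟨a₂, b₂, l₂, r₂, e₂⟩ := exists_tendsto_jacobiForm hf₀ hqmax
  -- Since ℓ[1] = 0 and ℓ[q] = 0, Green's formula equates the jumps of [f₀,1] and [f₀,q] with the
  -- two vanishing integrals of F.
  have hb₁ : b₁ = a₁ := by
    rw [← sub_eq_zero, ← e₁, ← h1]
    refine integral_congr_ae ?_
    filter_upwards [hℓ] with x hx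
    simp [hx, jacobiExpr_const]
  have hb₂ : b₂ = a₂ := by
    rw [← sub_eq_zero, ← e₂, ← hq]
    refine integral_congr_ae ?_
    filter_upwards [hℓ, jacobiExpr_jacobiSecond (α := α) (β := β)] with x hx hx'
    simp [hx, hx']
  rw [hb₁] at r₁
  rw [hb₂] at r₂
  have m1 := hqmax.smul a₁
  have m2 := h1max.smul (-a₂)
  have hf := (hf₀.add m1).add m2
  -- As [q,1] = -1, [1,q] = 1 and [1,1] = [q,q] = 0, these coefficients cancel the common boundary
  -- values a₁ and a₂ at both ends at once.
  set f := f₀ + a₁ • jacobiSecond α β + (-a₂) • (fun _ => (1 : ℂ)) with hf_def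
  have k1 : ∀ x ∈ Ioo (-1 : ℝ) 1,
      jacobiForm α β f₀ (fun _ => 1) x - a₁ = jacobiForm α β f (fun _ => 1) x := by
    intro x hx
    rw [hf_def, jacobiForm_add_left (hf₀.add m1) m2 _ hx, jacobiForm_add_left hf₀ m1 _ hx,
      jacobiForm_smul_left _ hqmax _ hx, jacobiForm_smul_left _ h1max _ hx,
      jacobiForm_const_one (jacobiSecond α β), coeff_smul_deriv_jacobiSecond hx,
      jacobiForm_const_one (fun _ => 1)]
    simp [sub_eq_add_neg]
  have k2 : ∀ x ∈ Ioo (-1 : ℝ) 1,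
      jacobiForm α β f₀ (jacobiSecond α β) x - a₂ = jacobiForm α β f (jacobiSecond α β) x := by
    intro x hx
    rw [hf_def, jacobiForm_add_left (hf₀.add m1) m2 _ hx, jacobiForm_add_left hf₀ m1 _ hx,
      jacobiForm_smul_left _ hqmax _ hx, jacobiForm_smul_left _ h1max _ hx,
      jacobiForm_jacobiSecond (jacobiSecond α β) hx, coeff_smul_deriv_jacobiSecond hx,
      jacobiForm_jacobiSecond (fun _ => 1) hx]
    simp [sub_eq_add_neg]
  refine ⟨f, ⟨hf, fun g hg => ⟨0, ?_, ?_⟩⟩, ?_⟩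
  · obtain ⟨c, -, hc, -⟩ := exists_tendsto_jacobiForm hg h1max
    obtain ⟨d, -, hd, -⟩ := exists_tendsto_jacobiForm hg hqmax
    have := ((l₁.sub_const a₁).mul hd.star).sub ((l₂.sub_const a₂).mul hc.star)
    rw [sub_self, sub_self, zero_mul, zero_mul, sub_self] at this
    refine this.congr' ?_
    filter_upwards [eventually_mem_Ioo_right] with x hx
    rw [k1 x hx, k2 x hx]
    exact (jacobiForm_eq_of_jacobiSecond f g hx).symm
  · obtain ⟨-, c, -, hc, -⟩ := exists_tendsto_jacobiForm hg h1max
    obtain ⟨-, d, -, hd, -⟩ := exists_tendsto_jacobiForm hg hqmax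
    have := ((r₁.sub_const a₁).mul hd.star).sub ((r₂.sub_const a₂).mul hc.star)
    rw [sub_self, sub_self, zero_mul, zero_mul, sub_self] at this
    refine this.congr' ?_
    filter_upwards [eventually_mem_Ioo_left] with x hx
    rw [k1 x hx, k2 x hx]
    exact (jacobiForm_eq_of_jacobiSecond f g hx).symm
  · filter_upwards [(hf₀.add m1).expr_add m2, hf₀.expr_add m1, hqmax.expr_smul a₁,
      h1max.expr_smul (-a₂), jacobiExpr_jacobiSecond (α := α) (β := β), hℓ] with x e1 e2 e3 e4 e5 e6
    rw [hf_def, e1, Pi.add_apply, e2, Pi.add_apply, e3, e4, e6]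
    simp [e5, jacobiExpr_const]

theorem adjoint_le_jacobiMax (hα₀ : 0 < α) (hα₁ : α < 1) (hβ₀ : 0 < β) (hβ₁ : β < 1) :
    (jacobiMin α β).adjoint ≤ jacobiMax α β := by
  have := isFiniteMeasure_jacobiMeasure hα₀.le hβ₀.le
  intro x hx
  have h1max : InJacobiMax α β (fun _ => (1 : ℂ)) := inJacobiMax_const hα₀ hβ₀ 1
  have hqmax := inJacobiMax_jacobiSecond hα₀ hα₁ hβ₀ hβ₁
  have hF : MemLp x.2 2 (jacobiMeasure α β) := Lp.memLp x.2
  have hg := inJacobiMax_jacobiSolution hα₀ hα₁ hβ₀ hβ₁ 0 hF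
  have hℓ := jacobiExpr_jacobiSolution 0 (hF.integrable (by norm_num))
  set g := jacobiSolution α β 0 x.2
  have hgx : (hg.memLp.toLp g, x.2) ∈ jacobiMax α β := ⟨g, hg, hg.memLp.coeFn_toLp, hℓ.symm⟩
  set one : JacobiL2 α β := h1max.memLp.toLp _ with hone
  set q : JacobiL2 α β := hqmax.memLp.toLp _ with hq
  have hone_mem : (one, 0) ∈ jacobiMax α β :=
    ⟨_, h1max, h1max.memLp.coeFn_toLp, by rw [jacobiExpr_const]; exact Lp.coeFn_zero _ _ _⟩
  have hq_mem : (q, 0) ∈ jacobiMax α β :=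
    ⟨_, hqmax, hqmax.memLp.coeFn_toLp, (Lp.coeFn_zero _ _ _).trans jacobiExpr_jacobiSecond.symm⟩
  have hk : (x - (hg.memLp.toLp g, x.2)) ∈ (jacobiMin α β).adjoint :=
    Submodule.sub_mem _ hx (jacobiMax_le_adjoint hgx)
  set S : Submodule ℂ (JacobiL2 α β) := Submodule.span ℂ {one, q}
  have : FiniteDimensional ℂ S := FiniteDimensional.span_of_finite ℂ (by simp)
  have hkS : x.1 - hg.memLp.toLp g ∈ S := by
    -- S is finite dimensional, so it equals its double orthogonal complement; it remains to test
    -- against each F orthogonal to 1 and q.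
    rw [← Submodule.orthogonal_orthogonal S, Submodule.mem_orthogonal]
    intro F hFS
    rw [Submodule.mem_orthogonal] at hFS
    have o1 := hFS one (Submodule.subset_span (by simp))
    have o2 := hFS q (Submodule.subset_span (by simp))
    rw [L2.inner_eq_integral h1max.memLp.coeFn_toLp (ae_eq_refl F)] at o1
    rw [L2.inner_eq_integral hqmax.memLp.coeFn_toLp (ae_eq_refl F)] at o2
    obtain ⟨f, hf, hfF⟩ := exists_mem_jacobiDMin hα₀ hα₁ hβ₀ hβ₁ (Lp.memLp F) (by simpa using o1) o2
    -- The second component of the difference is 0, so pairing it with (f, F) leaves only the inner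
    -- product with F.
    have := (Submodule.mem_adjoint_iff _ _).1 hk (hf.1.memLp.toLp f) F
      ⟨f, hf, hf.1.memLp.coeFn_toLp, hfF.symm⟩
    simpa using this
  obtain ⟨c, d, hcd⟩ := Submodule.mem_span_pair.1 hkS
  have hx' : x = c • (one, 0) + d • (q, 0) + (hg.memLp.toLp g, x.2) := by
    ext1
    · simp [hcd]
    · simp
  rw [hx']
  exact Submodule.add_mem _ (Submodule.add_mem _ (Submodule.smul_mem _ c hone_mem)
    (Submodule.smul_mem _ d hq_mem)) hgx

theorem adjoint_jacobiMin (hα₀ : 0 < α) (hα₁ : α < 1) (hβ₀ : 0 < β) (hβ₁ : β < 1) :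
    (jacobiMin α β).adjoint = jacobiMax α β :=
  le_antisymm (adjoint_le_jacobiMax hα₀ hα₁ hβ₀ hβ₁) jacobiMax_le_adjoint

theorem Submodule.isClosed_adjoint {E F : Type*} [NormedAddCommGroup E] [InnerProductSpace ℂ E]
    [NormedAddCommGroup F] [InnerProductSpace ℂ F] (S : Submodule ℂ (E × F)) :
    IsClosed (S.adjoint : Set (F × E)) := by
  have h : (S.adjoint : Set (F × E)) =
      ⋂ y ∈ S, {x : F × E | inner ℂ y.2 x.1 - inner ℂ y.1 x.2 = 0} := by
    ext x
    simp
  rw [h]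
  exact isClosed_biInter fun y _ => isClosed_eq (by fun_prop) continuous_const

/-- The maximal relation is closed, being an adjoint, and the orthogonality conditions cut out
closed subsets. -/
theorem isClosed_jacobiMin (hα₀ : 0 < α) (hα₁ : α < 1) (hβ₀ : 0 < β) (hβ₁ : β < 1) :
    IsClosed (jacobiMin α β : Set (JacobiL2 α β × JacobiL2 α β)) := by
  have h : (jacobiMin α β : Set (JacobiL2 α β × JacobiL2 α β)) =
      (jacobiMax α β : Set (JacobiL2 α β × JacobiL2 α β)) ∩
      ⋂ y ∈ jacobiMax α β, {z : JacobiL2 α β × JacobiL2 α β | inner ℂ y.1 z.2 - inner ℂ y.2 z.1 = 0} := by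
    ext z
    simpa using mem_jacobiMin_iff z
  rw [h, ← adjoint_jacobiMin hα₀ hα₁ hβ₀ hβ₁]
  exact (Submodule.isClosed_adjoint _).inter
    (isClosed_biInter fun y _ => isClosed_eq (by fun_prop) continuous_const)

end Graph

/-! ### The symmetry x ↦ -x, exchanging α with β and the two endpoints. -/

section Reflection

variable {α β : ℝ}

theorem jacobiCoeff_neg (x : ℝ) : jacobiCoeff α β (-x) = jacobiCoeff β α x := by
  simp only [jacobiCoeff, sub_neg_eq_add, ← sub_eq_add_neg]
  ring

theorem jacobiWeight_neg (x : ℝ) : jacobiWeight α β (-x) = jacobiWeight β α x := by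
  simp only [jacobiWeight, sub_neg_eq_add, ← sub_eq_add_neg]
  ring

theorem jacobiMajorant_neg (x : ℝ) : jacobiMajorant α β (-x) = jacobiMajorant β α x := by
  simp only [jacobiMajorant, sub_neg_eq_add, ← sub_eq_add_neg]
  ring

theorem coeff_smul_deriv_comp_neg (f : ℝ → ℂ) (x : ℝ) :
    jacobiCoeff β α x • deriv (fun t => f (-t)) x = -(jacobiCoeff α β (-x) • deriv f (-x)) := by
  rw [deriv_comp_neg, jacobiCoeff_neg, smul_neg]

theorem jacobiExpr_comp_neg (f : ℝ → ℂ) (x : ℝ) :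
    jacobiExpr β α (fun t => f (-t)) x = jacobiExpr α β f (-x) := by
  simp only [jacobiExpr, coeff_smul_deriv_comp_neg (α := α) (β := β), jacobiWeight_neg]
  rw [deriv.fun_neg, deriv_comp_neg (fun t => jacobiCoeff α β t • deriv f t), neg_neg]

theorem jacobiForm_comp_neg (f g : ℝ → ℂ) (x : ℝ) :
    jacobiForm β α (fun t => f (-t)) (fun t => g (-t)) x = -jacobiForm α β f g (-x) := by
  rw [jacobiForm_eq, jacobiForm_eq, coeff_smul_deriv_comp_neg, coeff_smul_deriv_comp_neg, map_neg]
  ring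

theorem tendsto_neg_nhdsGT_neg_one : Tendsto (fun x : ℝ => -x) (𝓝[>] (-1)) (𝓝[<] 1) := by
  simpa using tendsto_neg_nhdsGT (a := (-1 : ℝ))

theorem tendsto_neg_nhdsLT_one : Tendsto (fun x : ℝ => -x) (𝓝[<] 1) (𝓝[>] (-1)) :=
  tendsto_neg_nhdsLT

end Reflection

/-! ### Functions of the form k + c (1 + x)^(-β) near -1. -/

section Endpoint

variable {α β : ℝ} {f : ℝ → ℂ} {k c : ℂ} {δ : ℝ}

/-- Allows an identity valid near an endpoint to be differentiated there. -/
theorem eventually_nhds_of_nhdsGT {a : ℝ} {P : ℝ → Prop} (h : ∀ᶠ x in 𝓝[>] a, P x) :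
    ∀ᶠ x in 𝓝[>] a, ∀ᶠ y in 𝓝 x, P y := by
  filter_upwards [eventually_eventually_nhdsWithin.2 h, self_mem_nhdsWithin] with x hx hxa
  rwa [isOpen_Ioi.nhdsWithin_eq hxa] at hx

/-- The powers of 1 + x in p and f' cancel exactly. Hence p f' is smooth at -1, and ℓ[f] is no more
singular there than f. -/
theorem eventually_coeff_smul_deriv_left
    (hf : ∀ᶠ x in 𝓝[>] (-1 : ℝ), f x = k + ((1 + x) ^ (-β) : ℝ) • c) :
    ∀ᶠ x in 𝓝[>] (-1 : ℝ),
      jacobiCoeff α β x • deriv f x = (-(β * (1 - x) ^ (α + 1)) : ℝ) • c := by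
  filter_upwards [eventually_nhds_of_nhdsGT hf, eventually_mem_Ioo_right] with x hx hI
  have h2 : 0 < 1 + x := by linarith [hI.1]
  have h1 : HasDerivAt (fun t : ℝ => 1 + t) 1 x := (hasDerivAt_id x).const_add 1
  have h := ((h1.rpow_const (p := -β) (Or.inl h2.ne')).smul_const c).const_add k
  rw [EventuallyEq.deriv_eq hx, h.deriv, smul_smul, jacobiCoeff]
  congr 1
  have e : (1 + x) ^ (β + 1) * (1 + x) ^ (-β - 1) = 1 := by
    rw [← Real.rpow_add h2]
    simp
  linear_combination (-β * (1 - x) ^ (α + 1)) * e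

theorem eventually_jacobiExpr_left
    (hf : ∀ᶠ x in 𝓝[>] (-1 : ℝ), f x = k + ((1 + x) ^ (-β) : ℝ) • c) :
    ∀ᶠ x in 𝓝[>] (-1 : ℝ),
      jacobiExpr α β f x = (-(β * (α + 1) * (1 + x) ^ (-β)) : ℝ) • c := by
  filter_upwards [eventually_nhds_of_nhdsGT (eventually_coeff_smul_deriv_left (α := α) hf),
    eventually_mem_Ioo_right] with x hx hI
  have h2 : 0 < 1 + x := by linarith [hI.1]
  have h3 : 0 < 1 - x := by linarith [hI.2]
  have h1 : HasDerivAt (fun t : ℝ => 1 - t) (-1) x := (hasDerivAt_id x).const_sub 1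
  have h := (((h1.rpow_const (p := α + 1) (Or.inl h3.ne')).const_mul β).fun_neg).smul_const c
  simp only [jacobiExpr]
  rw [EventuallyEq.deriv_eq hx, h.deriv, smul_smul, ← neg_smul, jacobiWeight, add_sub_cancel_right,
    Real.rpow_neg h2.le]
  congr 1
  have := (Real.rpow_pos_of_pos h2 β).ne'
  have := (Real.rpow_pos_of_pos h3 α).ne'
  field_simp

theorem eventually_norm_le_left (hβ : 0 < β) :
    (∀ᶠ x in 𝓝[>] (-1 : ℝ), f x = k + ((1 + x) ^ (-β) : ℝ) • c) →
    ∃ C, ∀ᶠ x in 𝓝[>] (-1 : ℝ), ‖f x‖ ≤ C * jacobiMajorant α β x := by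
  intro hf
  refine ⟨‖k‖ + ‖c‖, ?_⟩
  filter_upwards [hf, Ioo_mem_nhdsGT (by norm_num : (-1 : ℝ) < 0)] with x hx hI
  have h2 : 0 < 1 + x := by linarith [hI.1]
  have h1 : 1 ≤ (1 + x) ^ (-β) :=
    Real.one_le_rpow_of_pos_of_le_one_of_nonpos h2 (by linarith [hI.2]) (by linarith)
  have h3 : 0 ≤ (1 - x) ^ (-α) := Real.rpow_nonneg (by linarith [hI.2]) _
  rw [hx, jacobiMajorant]
  refine (norm_add_le _ _).trans ?_
  rw [norm_smul, Real.norm_of_nonneg (by linarith)]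
  nlinarith [norm_nonneg k, norm_nonneg c, mul_nonneg (norm_nonneg k) h3,
    mul_nonneg (norm_nonneg c) h3]

/-- Between the two endpoint neighbourhoods, compactness bounds the continuous quotient of ‖F‖ by
the positive majorant. -/
theorem exists_norm_le_jacobiMajorant {F : ℝ → ℂ} (hF : ContinuousOn F (Ioo (-1) 1))
    (hl : ∃ C, ∀ᶠ x in 𝓝[>] (-1 : ℝ), ‖F x‖ ≤ C * jacobiMajorant α β x)
    (hr : ∃ C, ∀ᶠ x in 𝓝[<] (1 : ℝ), ‖F x‖ ≤ C * jacobiMajorant α β x) :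
    ∃ C, ∀ x ∈ Ioo (-1 : ℝ) 1, ‖F x‖ ≤ C * jacobiMajorant α β x := by
  obtain ⟨C₁, h₁⟩ := hl
  obtain ⟨C₂, h₂⟩ := hr
  obtain ⟨a, ha, ha'⟩ := (mem_nhdsGT_iff_exists_Ioo_subset' (by norm_num : (-1 : ℝ) < 0)).1 h₁
  obtain ⟨b, hb, hb'⟩ := (mem_nhdsLT_iff_exists_Ioo_subset' (by norm_num : (0 : ℝ) < 1)).1 h₂
  have hcont : ContinuousOn (jacobiMajorant α β) (Ioo (-1) 1) := by
    unfold jacobiMajorant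
    refine ContinuousOn.add (ContinuousOn.rpow_const (by fun_prop) ?_)
      (ContinuousOn.rpow_const (by fun_prop) ?_) <;> intro x hx <;> left <;>
    linarith [hx.1, hx.2]
  have hsub : Icc a b ⊆ Ioo (-1) 1 := fun x hx => ⟨lt_of_lt_of_le ha hx.1, lt_of_le_of_lt hx.2 hb⟩
  obtain ⟨C₃, h₃⟩ := isCompact_Icc.exists_bound_of_continuousOn
    ((hF.norm.div hcont fun x hx => (jacobiMajorant_pos hx).ne').mono hsub)
  refine ⟨max C₁ (max C₂ C₃), fun x hx => ?_⟩
  have hpos := jacobiMajorant_pos (α := α) (β := β) hx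
  by_cases hxa : x < a
  · exact (ha' ⟨hx.1, hxa⟩).trans (by gcongr; exact le_max_left _ _)
  by_cases hxb : b < x
  · exact (hb' ⟨hxb, hx.2⟩).trans
      (by gcongr; exact (le_max_left _ _).trans (le_max_right _ _))
  · have := (le_abs_self _).trans (h₃ x ⟨not_lt.1 hxa, not_lt.1 hxb⟩)
    exact ((div_le_iff₀ hpos).1 this).trans
      (by gcongr; exact (le_max_right _ _).trans (le_max_right _ _))

theorem inJacobiMax_of_contDiffOn (hα₀ : 0 < α) (hα₁ : α < 1) (hβ₀ : 0 < β) (hβ₁ : β < 1)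
    {k' c' : ℂ} (hf : ContDiffOn ℝ 2 f (Ioo (-1) 1))
    (hl : ∀ᶠ x in 𝓝[>] (-1 : ℝ), f x = k + ((1 + x) ^ (-β) : ℝ) • c)
    (hr : ∀ᶠ x in 𝓝[<] (1 : ℝ), f x = k' + ((1 - x) ^ (-α) : ℝ) • c') :
    InJacobiMax α β f := by
  have hr' : ∀ᶠ x in 𝓝[>] (-1 : ℝ), f (-x) = k' + ((1 + x) ^ (-α) : ℝ) • c' := by
    filter_upwards [tendsto_neg_nhdsGT_neg_one.eventually hr] with x hx
    rw [hx, sub_neg_eq_add]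
  have hd : ContDiffOn ℝ 1 (deriv f) (Ioo (-1) 1) := hf.deriv_of_isOpen isOpen_Ioo (by norm_num)
  have hpd : ContDiffOn ℝ 1 (fun x => jacobiCoeff α β x • deriv f x) (Ioo (-1) 1) :=
    (contDiffOn_jacobiCoeff (n := 1)).smul hd
  have hexpr : ContinuousOn (jacobiExpr α β f) (Ioo (-1) 1) := by
    unfold jacobiExpr
    exact ((continuousOn_jacobiWeight.inv₀ fun x hx => (jacobiWeight_pos hx).ne').smul
      (hpd.continuousOn_deriv_of_isOpen isOpen_Ioo le_rfl)).neg
  have right_bound : ∀ F : ℝ → ℂ,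
      (∃ C, ∀ᶠ x in 𝓝[>] (-1 : ℝ), ‖F (-x)‖ ≤ C * jacobiMajorant β α x) →
      ∃ C, ∀ᶠ x in 𝓝[<] (1 : ℝ), ‖F x‖ ≤ C * jacobiMajorant α β x := by
    rintro F ⟨C, hC⟩
    refine ⟨C, ?_⟩
    filter_upwards [tendsto_neg_nhdsLT_one.eventually hC] with x hx
    rwa [neg_neg, jacobiMajorant_neg] at hx
  refine ⟨fun x hx => (hf.differentiableOn (by norm_num)).differentiableAt (isOpen_Ioo.mem_nhds hx),
    acLocOn_of_contDiffOn (hf.of_le (by norm_num)), acLocOn_of_contDiffOn hd, ?_, ?_⟩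
  · obtain ⟨C, hC⟩ := exists_norm_le_jacobiMajorant hf.continuousOn (eventually_norm_le_left hβ₀ hl)
      (right_bound f (eventually_norm_le_left hα₀ hr'))
    exact memLp_of_norm_le_jacobiMajorant hα₀ hα₁ hβ₀ hβ₁ hf.continuousOn C hC
  · have el := eventually_jacobiExpr_left (α := α) hl
    have er := eventually_jacobiExpr_left (α := β) hr'
    simp only [jacobiExpr_comp_neg (α := α) (β := β)] at er
    -- Near each end ℓ[f] again has the form treated above, with k = 0.
    obtain ⟨C, hC⟩ := exists_norm_le_jacobiMajorant hexpr
      (eventually_norm_le_left (k := 0) (c := (-(β * (α + 1)) : ℝ) • c) hβ₀ (by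
        filter_upwards [el] with x hx
        rw [hx, smul_smul, zero_add]
        congr 1
        ring))
      (right_bound _ (eventually_norm_le_left (k := 0) (c := (-(α * (β + 1)) : ℝ) • c') hα₀ (by
        filter_upwards [er] with x hx
        rw [hx, smul_smul, zero_add]
        congr 1
        ring)))
    exact memLp_of_norm_le_jacobiMajorant hα₀ hα₁ hβ₀ hβ₁ hexpr C hC

end Endpoint

/-! ### Boundary values computed with the comparison function v. -/

section Comparison

variable {α β : ℝ} {v : ℝ → ℝ} {f g : ℝ → ℂ}

theorem eventually_coe_eq_left
    (hv : ∀ᶠ x in 𝓝[>] (-1 : ℝ), v x = (1 + x) ^ (-β) / (β * 2 ^ (α + 1))) :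
    ∀ᶠ x in 𝓝[>] (-1 : ℝ),
      (v x : ℂ) = 0 + ((1 + x) ^ (-β) : ℝ) • (((β * 2 ^ (α + 1))⁻¹ : ℝ) : ℂ) := by
  filter_upwards [hv] with x hx
  rw [hx, zero_add, Complex.real_smul, div_eq_mul_inv, Complex.ofReal_mul]

theorem eventually_coeff_deriv_eq_left (hβ : 0 < β)
    (hv : ∀ᶠ x in 𝓝[>] (-1 : ℝ), v x = (1 + x) ^ (-β) / (β * 2 ^ (α + 1))) :
    ∀ᶠ x in 𝓝[>] (-1 : ℝ), jacobiCoeff α β x • deriv (fun x => (v x : ℂ)) x =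
      ((-((1 - x) ^ (α + 1) / 2 ^ (α + 1)) : ℝ) : ℂ) := by
  filter_upwards [eventually_coeff_smul_deriv_left (α := α) (eventually_coe_eq_left hv)] with x hx
  rw [hx, Complex.real_smul, ← Complex.ofReal_mul]
  congr 1
  field_simp

theorem tendsto_ratio_left : Tendsto (fun x : ℝ => (1 - x) ^ (α + 1) / 2 ^ (α + 1))
    (𝓝[>] (-1)) (𝓝 1) := by
  have h : ContinuousAt (fun x : ℝ => (1 - x) ^ (α + 1) / 2 ^ (α + 1)) (-1) :=
    (ContinuousAt.rpow_const (by fun_prop) (Or.inl (by norm_num))).div_const _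
  have := h.tendsto.mono_left (nhdsWithin_le_nhds (s := Ioi (-1)))
  rwa [sub_neg_eq_add, one_add_one_eq_two, div_self (by positivity)] at this

theorem tendsto_coeff_deriv_left (hβ : 0 < β)
    (hv : ∀ᶠ x in 𝓝[>] (-1 : ℝ), v x = (1 + x) ^ (-β) / (β * 2 ^ (α + 1))) :
    Tendsto (fun x => jacobiCoeff α β x • deriv (fun x => (v x : ℂ)) x) (𝓝[>] (-1)) (𝓝 (-1)) := by
  refine Tendsto.congr' ((eventually_coeff_deriv_eq_left hβ hv).mono fun _ h => h.symm) ?_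
  have := (Complex.continuous_ofReal.tendsto _).comp (tendsto_ratio_left (α := α)).neg
  rwa [Complex.ofReal_neg, Complex.ofReal_one] at this

theorem eventually_reflect
    (hv : ∀ᶠ x in 𝓝[<] (1 : ℝ), v x = (1 - x) ^ (-α) / (α * 2 ^ (β + 1))) :
    ∀ᶠ x in 𝓝[>] (-1 : ℝ), v (-x) = (1 + x) ^ (-α) / (α * 2 ^ (β + 1)) := by
  filter_upwards [tendsto_neg_nhdsGT_neg_one.eventually hv] with x hx
  rw [hx, sub_neg_eq_add]

theorem tendsto_coeff_deriv_right (hα : 0 < α)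
    (hv : ∀ᶠ x in 𝓝[<] (1 : ℝ), v x = (1 - x) ^ (-α) / (α * 2 ^ (β + 1))) :
    Tendsto (fun x => jacobiCoeff α β x • deriv (fun x => (v x : ℂ)) x) (𝓝[<] 1) (𝓝 1) := by
  have h := ((tendsto_coeff_deriv_left hα (eventually_reflect hv)).comp tendsto_neg_nhdsLT_one).neg
  rw [neg_neg] at h
  refine h.congr fun x => ?_
  simp only [Function.comp_apply]
  rw [coeff_smul_deriv_comp_neg (α := α) (β := β) (fun x => (v x : ℂ)), neg_neg, neg_neg]

theorem boundaryValues_left (hβ : 0 < β)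
    (hv : ∀ᶠ x in 𝓝[>] (-1 : ℝ), v x = (1 + x) ^ (-β) / (β * 2 ^ (α + 1))) {a b : ℂ}
    (ha : Tendsto (jacobiForm α β f fun _ => 1) (𝓝[>] (-1)) (𝓝 a))
    (hb : Tendsto (jacobiForm α β f fun x => (v x : ℂ)) (𝓝[>] (-1)) (𝓝 b)) :
    Tendsto (fun x => f x / (v x : ℂ)) (𝓝[>] (-1)) (𝓝 a) ∧
      Tendsto (fun x => -f x - ((1 + x) / β) • deriv f x) (𝓝[>] (-1)) (𝓝 b) ∧
      Tendsto (fun x => (β * 2 ^ (α + 1) * (1 + x) ^ β) • f x) (𝓝[>] (-1)) (𝓝 a) := by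
  have hinv : ∀ᶠ x in 𝓝[>] (-1 : ℝ), (v x)⁻¹ = β * 2 ^ (α + 1) * (1 + x) ^ β := by
    filter_upwards [hv, eventually_mem_Ioo_right] with x hx hI
    rw [hx, inv_div, Real.rpow_neg (by linarith [hI.1]), div_inv_eq_mul]
  have hinv0 : Tendsto (fun x => ((v x : ℂ))⁻¹) (𝓝[>] (-1)) (𝓝 0) := by
    have h : ContinuousAt (fun x : ℝ => β * 2 ^ (α + 1) * (1 + x) ^ β) (-1) :=
      (ContinuousAt.rpow_const (by fun_prop) (Or.inr hβ.le)).const_mul _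
    have h' := h.tendsto.mono_left (nhdsWithin_le_nhds (s := Ioi (-1)))
    rw [add_neg_cancel, Real.zero_rpow hβ.ne', mul_zero] at h'
    have := (Complex.continuous_ofReal.tendsto _).comp
      (h'.congr' (hinv.mono fun _ h => h.symm))
    simpa [Function.comp_def] using this
  have hpv := eventually_coeff_deriv_eq_left hβ hv
  have h1 : Tendsto (fun x => f x / (v x : ℂ)) (𝓝[>] (-1)) (𝓝 a) := by
    -- Here f / v = ([f,v] / v - [f,1]) / (p v'), where 1 / v → 0 and p v' → -1.
    have := ((hb.mul hinv0).sub ha).div (tendsto_coeff_deriv_left hβ hv) (by norm_num)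
    rw [mul_zero, zero_sub, neg_div_neg_eq, div_one] at this
    refine this.congr' ?_
    filter_upwards [hpv, hv, eventually_mem_Ioo_right] with x hx hvx hI
    have h2 : 0 < 1 + x := by linarith [hI.1]
    have h3 : 0 < 1 - x := by linarith [hI.2]
    have hr : (1 - x) ^ (α + 1) / 2 ^ (α + 1) ≠ 0 :=
      (div_pos (Real.rpow_pos_of_pos h3 _) (by positivity)).ne'
    have hv0 : (v x : ℂ) ≠ 0 := by
      rw [hvx]
      exact Complex.ofReal_ne_zero.2 (div_pos (Real.rpow_pos_of_pos h2 _) (by positivity)).ne'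
    simp only [Pi.div_apply]
    rw [jacobiForm_const_one, jacobiForm_eq, hx, Complex.conj_ofReal, Complex.conj_ofReal,
      div_eq_div_iff (by exact_mod_cast neg_ne_zero.2 hr) hv0]
    field_simp
    ring
  refine ⟨h1, ?_, h1.congr' ?_⟩
  -- With r = ((1 - x) / 2)^(α + 1) → 1, near -1 one has p v' = -r and p v = r (1 + x) / β, so [f,v]
  -- / r is exactly the required expression.
  · have := hb.div ((Complex.continuous_ofReal.tendsto _).comp (tendsto_ratio_left (α := α)))
      (by norm_num)
    rw [Complex.ofReal_one, div_one] at this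
    refine this.congr' ?_
    filter_upwards [hpv, hv, eventually_mem_Ioo_right] with x hx hvx hI
    have h2 : 0 < 1 + x := by linarith [hI.1]
    have h3 : 0 < 1 - x := by linarith [hI.2]
    have hr : (((1 - x) ^ (α + 1) / 2 ^ (α + 1) : ℝ) : ℂ) ≠ 0 :=
      Complex.ofReal_ne_zero.2 (div_pos (Real.rpow_pos_of_pos h3 _) (by positivity)).ne'
    have e : jacobiCoeff α β x * v x = (1 - x) ^ (α + 1) / 2 ^ (α + 1) * ((1 + x) / β) := by
      rw [hvx, jacobiCoeff, Real.rpow_add h2, Real.rpow_one, Real.rpow_neg h2.le]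
      have := (Real.rpow_pos_of_pos h2 β).ne'
      field_simp
    have e' : (jacobiCoeff α β x : ℂ) * v x =
        (((1 - x) ^ (α + 1) / 2 ^ (α + 1) : ℝ) : ℂ) * (((1 + x) / β : ℝ) : ℂ) := by
      exact_mod_cast e
    simp only [Pi.div_apply, Function.comp_apply]
    rw [jacobiForm_eq, hx, Complex.conj_ofReal, Complex.conj_ofReal, div_eq_iff hr,
      Complex.real_smul, Complex.real_smul, Complex.ofReal_neg]
    linear_combination (-deriv f x) * e'
  · filter_upwards [hinv] with x hx
    rw [div_eq_mul_inv, ← Complex.ofReal_inv, hx, Complex.real_smul, mul_comm]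

theorem boundaryValues_right (hα : 0 < α)
    (hv : ∀ᶠ x in 𝓝[<] (1 : ℝ), v x = (1 - x) ^ (-α) / (α * 2 ^ (β + 1))) {a b : ℂ}
    (ha : Tendsto (jacobiForm α β f fun _ => 1) (𝓝[<] 1) (𝓝 a))
    (hb : Tendsto (jacobiForm α β f fun x => (v x : ℂ)) (𝓝[<] 1) (𝓝 b)) :
    Tendsto (fun x => -(f x / (v x : ℂ))) (𝓝[<] 1) (𝓝 a) ∧
      Tendsto (fun x => f x - ((1 - x) / α) • deriv f x) (𝓝[<] 1) (𝓝 b) ∧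
      Tendsto (fun x => -((α * 2 ^ (β + 1) * (1 - x) ^ α) • f x)) (𝓝[<] 1) (𝓝 a) := by
  have ha' : Tendsto (jacobiForm β α (fun t => f (-t)) fun _ => 1) (𝓝[>] (-1)) (𝓝 (-a)) :=
    (ha.comp tendsto_neg_nhdsGT_neg_one).neg.congr
      fun x => (jacobiForm_comp_neg f (fun _ => 1) x).symm
  have hb' : Tendsto (jacobiForm β α (fun t => f (-t)) fun x => (v (-x) : ℂ))
      (𝓝[>] (-1)) (𝓝 (-b)) :=
    (hb.comp tendsto_neg_nhdsGT_neg_one).neg.congr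
      fun x => (jacobiForm_comp_neg f (fun x => (v x : ℂ)) x).symm
  obtain ⟨h1, h2, h3⟩ := boundaryValues_left hα (eventually_reflect hv) ha' hb'
  have k1 := (h1.comp tendsto_neg_nhdsLT_one).neg
  have k2 := (h2.comp tendsto_neg_nhdsLT_one).neg
  have k3 := (h3.comp tendsto_neg_nhdsLT_one).neg
  rw [neg_neg] at k1 k2 k3
  refine ⟨k1.congr fun x => ?_, k2.congr fun x => ?_, k3.congr fun x => ?_⟩
  · simp
  · simp only [Function.comp_apply, deriv_comp_neg, neg_neg, smul_neg, ← sub_eq_add_neg]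
    ring
  · simp [← sub_eq_add_neg]

theorem conj_deriv_ofReal (v : ℝ → ℝ) (x : ℝ) :
    conj (deriv (fun x => (v x : ℂ)) x) = deriv (fun x => (v x : ℂ)) x := by
  have h := (deriv.star (f := fun x => (v x : ℂ)) (x := x)).symm
  simpa using h

/-- The Plücker identity with v in place of q. It is pure algebra, using only that v and p are real.
-/
theorem jacobiForm_mul_coeff_deriv (f g : ℝ → ℂ) (v : ℝ → ℝ) (x : ℝ) :
    jacobiForm α β f g x * (jacobiCoeff α β x • deriv (fun x => (v x : ℂ)) x) =
      jacobiForm α β f (fun _ => 1) x * conj (jacobiForm α β g (fun x => (v x : ℂ)) x) -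
        jacobiForm α β f (fun x => (v x : ℂ)) x * conj (jacobiForm α β g (fun _ => 1) x) := by
  rw [jacobiForm_const_one, jacobiForm_const_one]
  simp only [jacobiForm_eq, Complex.real_smul, map_sub, map_mul, map_neg,
    Complex.conj_ofReal, conj_deriv_ofReal]
  ring

end Comparison

/-! ### Boundary maps on the graph and their surjectivity. -/

section BoundaryMaps

variable {α β : ℝ} {f g : ℝ → ℂ}

theorem jacobiForm_congr_left {h : ℝ → ℂ} {x : ℝ} (hfg : f =ᶠ[𝓝 x] g) :
    jacobiForm α β f h x = jacobiForm α β g h x := by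
  rw [jacobiForm, jacobiForm, hfg.eq_of_nhds, hfg.deriv_eq]

/-- Both functions are continuous, and the weight is positive on (-1, 1). So boundary values depend
only on the L² class. -/
theorem InJacobiMax.eqOn_of_ae_eq (hf : InJacobiMax α β f) (hg : InJacobiMax α β g)
    (h : f =ᵐ[jacobiMeasure α β] g) : EqOn f g (Ioo (-1) 1) :=
  Measure.eqOn_open_of_ae_eq ((ae_restrict_iff' measurableSet_Ioo).2 (ae_of_ae_jacobiMeasure h))
    isOpen_Ioo hf.acLoc.continuousOn hg.acLoc.continuousOn

theorem InJacobiMax.jacobiForm_congr (hf : InJacobiMax α β f) (hg : InJacobiMax α β g)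
    (h : f =ᵐ[jacobiMeasure α β] g) (u : ℝ → ℂ) {x : ℝ} (hx : x ∈ Ioo (-1 : ℝ) 1) :
    jacobiForm α β f u x = jacobiForm α β g u x := by
  refine jacobiForm_congr_left ?_
  filter_upwards [isOpen_Ioo.mem_nhds hx] with t ht using hf.eqOn_of_ae_eq hg h ht

/-- The boundary values of `[f, u]` define a linear map on the maximal relation. -/
theorem exists_boundaryMap {u : ℝ → ℂ} (hu : InJacobiMax α β u)
    {S : Submodule ℂ (JacobiL2 α β × JacobiL2 α β)} (hS : S ≤ jacobiMax α β) :
    ∃ Γ : S →ₗ[ℂ] EuclideanSpace ℂ (Fin 2), ∀ (z : S) (f : ℝ → ℂ), InJacobiMax α β f →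
      (z : JacobiL2 α β × JacobiL2 α β).1 =ᵐ[jacobiMeasure α β] f →
      Tendsto (jacobiForm α β f u) (𝓝[>] (-1)) (𝓝 (Γ z 0)) ∧
        Tendsto (jacobiForm α β f u) (𝓝[<] 1) (𝓝 (Γ z 1)) := by
  choose F hF hF₁ hF₂ using fun z : S => hS z.2
  replace hF : ∀ z, InJacobiMax α β (F z) := hF
  choose a b ha hb hab using fun z : S => exists_tendsto_jacobiForm (hF z) hu
  -- The limits do not depend on the chosen representative, so sums and multiples of representatives
  -- can be used to check linearity.
  have key : ∀ (z : S) (f : ℝ → ℂ), InJacobiMax α β f →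
      (z : JacobiL2 α β × JacobiL2 α β).1 =ᵐ[jacobiMeasure α β] f →
      Tendsto (jacobiForm α β f u) (𝓝[>] (-1)) (𝓝 (a z)) ∧
        Tendsto (jacobiForm α β f u) (𝓝[<] 1) (𝓝 (b z)) := by
    intro z f hf hzf
    have hcongr := fun x hx =>
      (hF z).jacobiForm_congr hf ((hF₁ z).symm.trans hzf) u (x := x) hx
    exact ⟨(ha z).congr' (eventually_mem_Ioo_right.mono hcongr),
      (hb z).congr' (eventually_mem_Ioo_left.mono hcongr)⟩
  refine ⟨{ toFun := fun z => !₂[a z, b z], map_add' := ?_, map_smul' := ?_ }, fun z f hf hzf => ?_⟩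
  · intro y z
    have h := key (y + z) (F y + F z) ((hF y).add (hF z))
      ((Lp.coeFn_add _ _).trans ((hF₁ y).add (hF₁ z)))
    have hadd := fun x hx => (jacobiForm_add_left (hF y) (hF z) u (x := x) hx).symm
    have h1 := tendsto_nhds_unique h.1
      (((ha y).add (ha z)).congr' (eventually_mem_Ioo_right.mono hadd))
    have h2 := tendsto_nhds_unique h.2
      (((hb y).add (hb z)).congr' (eventually_mem_Ioo_left.mono hadd))
    ext i
    fin_cases i
    · simpa using h1
    · simpa using h2
  · intro c z
    have h := key (c • z) (c • F z) ((hF z).smul c)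
      ((Lp.coeFn_smul _ _).trans ((hF₁ z).const_smul c))
    have hsmul := fun x hx => (jacobiForm_smul_left c (hF z) u (x := x) hx).symm
    have h1 := tendsto_nhds_unique h.1
      (((ha z).const_mul c).congr' (eventually_mem_Ioo_right.mono hsmul))
    have h2 := tendsto_nhds_unique h.2
      (((hb z).const_mul c).congr' (eventually_mem_Ioo_left.mono hsmul))
    ext i
    fin_cases i
    · simpa using h1
    · simpa using h2
  · simpa using key z f hf hzf

/-- Since [v,v] = 0 and [1,1] = 0, pairing with v sees only k and pairing with 1 sees only c. -/
theorem tendsto_jacobiForm_combination {v : ℝ → ℝ} {l : Filter ℝ} {s : ℂ} (k c : ℂ)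
    (hd : ∀ᶠ x in l, DifferentiableAt ℝ v x)
    (hs : Tendsto (fun x => jacobiCoeff α β x • deriv (fun x => (v x : ℂ)) x) l (𝓝 s))
    (hf : ∀ᶠ x in l, f =ᶠ[𝓝 x] fun x => k + c * (v x : ℂ)) :
    Tendsto (jacobiForm α β f fun x => (v x : ℂ)) l (𝓝 (k * s)) ∧
      Tendsto (jacobiForm α β f fun _ => 1) l (𝓝 (-(c * s))) := by
  have hderiv : ∀ x, DifferentiableAt ℝ v x →
      deriv (fun x => k + c * (v x : ℂ)) x = c * deriv (fun x => (v x : ℂ)) x := by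
    intro x hx
    exact ((hx.hasDerivAt.ofReal_comp.differentiableAt.hasDerivAt.const_mul c).const_add k).deriv
  refine ⟨(hs.const_mul k).congr' ?_, (hs.const_mul c).neg.congr' ?_⟩
  · filter_upwards [hd, hf] with x hx hfx
    rw [jacobiForm_congr_left hfx, jacobiForm, hderiv x hx, conj_deriv_ofReal, Complex.conj_ofReal]
    simp only [Complex.real_smul]
    ring
  · filter_upwards [hd, hf] with x hx hfx
    rw [jacobiForm_congr_left hfx, jacobiForm_const_one, hderiv x hx]
    simp only [Complex.real_smul]
    ring

/-- Functions in the maximal domain realize all boundary values. -/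
theorem exists_inJacobiMax_tendsto (hα₀ : 0 < α) (hα₁ : α < 1) (hβ₀ : 0 < β) (hβ₁ : β < 1)
    {v : ℝ → ℝ} (hv : ContDiffOn ℝ 2 v (Ioo (-1) 1))
    (hv_left : ∀ᶠ x in 𝓝[>] (-1 : ℝ), v x = (1 + x) ^ (-β) / (β * 2 ^ (α + 1)))
    (hv_right : ∀ᶠ x in 𝓝[<] (1 : ℝ), v x = (1 - x) ^ (-α) / (α * 2 ^ (β + 1)))
    (a₀ a₁ b₀ b₁ : ℂ) :
    ∃ f, InJacobiMax α β f ∧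
      Tendsto (jacobiForm α β f fun x => (v x : ℂ)) (𝓝[>] (-1)) (𝓝 a₀) ∧
      Tendsto (jacobiForm α β f fun x => (v x : ℂ)) (𝓝[<] 1) (𝓝 a₁) ∧
      Tendsto (jacobiForm α β f fun _ => 1) (𝓝[>] (-1)) (𝓝 b₀) ∧
      Tendsto (jacobiForm α β f fun _ => 1) (𝓝[<] 1) (𝓝 b₁) := by
  set φ : ℝ → ℝ := fun x => Real.smoothTransition x with hφ
  -- A smooth cutoff glues -a₀ + b₀ v on the left to a₁ - b₁ v on the right; the signs come from p
  -- v' → -1 at -1 and p v' → 1 at 1.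
  set f : ℝ → ℂ := fun x => (1 - (φ (x + 1 / 2) : ℂ)) * (-a₀ + b₀ * (v x : ℂ)) +
    (φ (x + 1 / 2) : ℂ) * (a₁ + -b₁ * (v x : ℂ)) with hf
  have hvC : ContDiffOn ℝ 2 (fun x => (v x : ℂ)) (Ioo (-1) 1) :=
    Complex.ofRealCLM.contDiff.comp_contDiffOn hv
  have hφC : ContDiff ℝ 2 (fun x => (φ (x + 1 / 2) : ℂ)) :=
    Complex.ofRealCLM.contDiff.comp (Real.smoothTransition.contDiff.comp (by fun_prop))
  have hfC : ContDiffOn ℝ 2 f (Ioo (-1) 1) :=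
    ((contDiffOn_const.sub hφC.contDiffOn).mul
      (contDiffOn_const.add (contDiffOn_const.mul hvC))).add
      (hφC.contDiffOn.mul (contDiffOn_const.add (contDiffOn_const.mul hvC)))
  have hl : ∀ x < -(1 / 2 : ℝ), f x = -a₀ + b₀ * (v x : ℂ) := by
    intro x hx
    simp [hf, hφ, Real.smoothTransition.zero_of_nonpos (by linarith : x + 2⁻¹ ≤ 0)]
  have hr : ∀ x > (1 / 2 : ℝ), f x = a₁ + -b₁ * (v x : ℂ) := by
    intro x hx
    simp [hf, hφ, Real.smoothTransition.one_of_one_le (by linarith : 1 ≤ x + 2⁻¹)]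
  have hl' : ∀ᶠ x in 𝓝[>] (-1 : ℝ), x < -(1 / 2 : ℝ) := by
    filter_upwards [Ioo_mem_nhdsGT (by norm_num : (-1 : ℝ) < -(1 / 2))] with x hx using hx.2
  have hr' : ∀ᶠ x in 𝓝[<] (1 : ℝ), x > (1 / 2 : ℝ) := by
    filter_upwards [Ioo_mem_nhdsLT (by norm_num : (1 / 2 : ℝ) < 1)] with x hx using hx.1
  have hdiff : ∀ x ∈ Ioo (-1 : ℝ) 1, DifferentiableAt ℝ v x := fun x hx =>
    (hv.differentiableOn (by norm_num)).differentiableAt (isOpen_Ioo.mem_nhds hx)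
  have L := tendsto_jacobiForm_combination (-a₀) b₀ (eventually_mem_Ioo_right.mono hdiff)
    (tendsto_coeff_deriv_left hβ₀ hv_left)
    (hl'.mono fun x hx => (eventually_lt_nhds hx).mono fun t ht => hl t ht)
  have R := tendsto_jacobiForm_combination a₁ (-b₁) (eventually_mem_Ioo_left.mono hdiff)
    (tendsto_coeff_deriv_right hα₀ hv_right)
    (hr'.mono fun x hx => (eventually_gt_nhds hx).mono fun t ht => hr t ht)
  simp only [mul_neg, mul_one, neg_neg] at L R
  refine ⟨f, ?_, L.1, R.1, L.2, R.2⟩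
  refine inJacobiMax_of_contDiffOn hα₀ hα₁ hβ₀ hβ₁ hfC (k := -a₀) (k' := a₁)
    (c := b₀ * (((β * 2 ^ (α + 1))⁻¹ : ℝ) : ℂ)) (c' := -b₁ * (((α * 2 ^ (β + 1))⁻¹ : ℝ) : ℂ)) ?_ ?_
  · filter_upwards [hl', hv_left] with x hx hvx
    rw [hl x hx, hvx, Complex.real_smul, div_eq_mul_inv, Complex.ofReal_mul]
    ring
  · filter_upwards [hr', hv_right] with x hx hvx
    rw [hr x hx, hvx, Complex.real_smul, div_eq_mul_inv, Complex.ofReal_mul]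
    ring

theorem inJacobiMax_comparison (hα₀ : 0 < α) (hα₁ : α < 1) (hβ₀ : 0 < β) (hβ₁ : β < 1)
    {v : ℝ → ℝ} (hv : ContDiffOn ℝ 2 v (Ioo (-1) 1))
    (hv_left : ∀ᶠ x in 𝓝[>] (-1 : ℝ), v x = (1 + x) ^ (-β) / (β * 2 ^ (α + 1)))
    (hv_right : ∀ᶠ x in 𝓝[<] (1 : ℝ), v x = (1 - x) ^ (-α) / (α * 2 ^ (β + 1))) :
    InJacobiMax α β (fun x => (v x : ℂ)) := by
  refine inJacobiMax_of_contDiffOn hα₀ hα₁ hβ₀ hβ₁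
    (Complex.ofRealCLM.contDiff.comp_contDiffOn hv) (eventually_coe_eq_left hv_left)
    (k' := 0) (c' := (((α * 2 ^ (β + 1))⁻¹ : ℝ) : ℂ)) ?_
  filter_upwards [hv_right] with x hx
  rw [hx, zero_add, Complex.real_smul, div_eq_mul_inv, Complex.ofReal_mul]

end BoundaryMaps

end

/-! ### The boundary triple. -/

theorem mainTheorem10 (α β : ℝ) (hα₀ : 0 < α) (hα₁ : α < 1) (hβ₀ : 0 < β) (hβ₁ : β < 1)
    (v : ℝ → ℝ) (hv : ContDiffOn ℝ 2 v (Ioo (-1) 1))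
    (hv_left : ∀ᶠ x in 𝓝[>] (-1 : ℝ), v x = (1 + x) ^ (-β) / (β * 2 ^ (α + 1)))
    (hv_right : ∀ᶠ x in 𝓝[<] (1 : ℝ), v x = (1 - x) ^ (-α) / (α * 2 ^ (β + 1))) :
    (jacobiMin α β).adjoint = jacobiMax α β ∧
    ∃ Γ₀ Γ₁ : (jacobiMin α β).adjoint →ₗ[ℂ] EuclideanSpace ℂ (Fin 2),
      (∀ (z : (jacobiMin α β).adjoint) (f : ℝ → ℂ), f ∈ jacobiDMax α β →
        (z : JacobiL2 α β × JacobiL2 α β).1 =ᵐ[jacobiMeasure α β] f →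
        -- the defining boundary values
        (Tendsto (jacobiForm α β f (fun x => (v x : ℂ))) (𝓝[>] (-1)) (𝓝 (Γ₀ z 0)) ∧
          Tendsto (jacobiForm α β f (fun x => (v x : ℂ))) (𝓝[<] 1) (𝓝 (Γ₀ z 1)) ∧
          Tendsto (fun x => f x / (v x : ℂ)) (𝓝[>] (-1)) (𝓝 (Γ₁ z 0)) ∧
          Tendsto (fun x => -(f x / (v x : ℂ))) (𝓝[<] 1) (𝓝 (Γ₁ z 1))) ∧
        -- the explicit formulas
        (Tendsto (fun x => -f x - ((1 + x) / β) • deriv f x) (𝓝[>] (-1)) (𝓝 (Γ₀ z 0)) ∧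
          Tendsto (fun x => f x - ((1 - x) / α) • deriv f x) (𝓝[<] 1) (𝓝 (Γ₀ z 1)) ∧
          Tendsto (fun x => (β * 2 ^ (α + 1) * (1 + x) ^ β) • f x)
            (𝓝[>] (-1)) (𝓝 (Γ₁ z 0)) ∧
          Tendsto (fun x => -((α * 2 ^ (β + 1) * (1 - x) ^ α) • f x))
            (𝓝[<] 1) (𝓝 (Γ₁ z 1)))) ∧
      IsBoundaryTriple (jacobiMin α β) Γ₀ Γ₁ := by
  have hadj := adjoint_jacobiMin hα₀ hα₁ hβ₀ hβ₁
  -- Γ₀ collects the boundary values of [f,v] and Γ₁ those of [f,1].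
  obtain ⟨Γ₀, hΓ₀⟩ := exists_boundaryMap
    (inJacobiMax_comparison hα₀ hα₁ hβ₀ hβ₁ hv hv_left hv_right) hadj.le
  obtain ⟨Γ₁, hΓ₁⟩ := exists_boundaryMap (inJacobiMax_const hα₀ hβ₀ 1) hadj.le
  refine ⟨hadj, Γ₀, Γ₁, fun z f hf hz => ?_, isClosed_jacobiMin hα₀ hα₁ hβ₀ hβ₁,
    hadj ▸ jacobiMin_le_jacobiMax, ?_, ?_⟩
  · obtain ⟨l₀, r₀⟩ := hΓ₀ z f hf hz
    obtain ⟨l₁, r₁⟩ := hΓ₁ z f hf hz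
    obtain ⟨p1, p2, p3⟩ := boundaryValues_left hβ₀ hv_left l₁ l₀
    obtain ⟨q1, q2, q3⟩ := boundaryValues_right hα₀ hv_right r₁ r₀
    exact ⟨⟨l₀, r₀, p1, q1⟩, p2, q2, p3, q3⟩
  · rintro ⟨a, b⟩
    obtain ⟨f, hf, t1, t2, t3, t4⟩ := exists_inJacobiMax_tendsto hα₀ hα₁ hβ₀ hβ₁ hv hv_left hv_right
      (a 0) (a 1) (b 0) (b 1)
    let z : (jacobiMin α β).adjoint := ⟨_, hadj.ge (toLp_mem_jacobiMax hf)⟩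
    obtain ⟨l₀, r₀⟩ := hΓ₀ z f hf hf.memLp.coeFn_toLp
    obtain ⟨l₁, r₁⟩ := hΓ₁ z f hf hf.memLp.coeFn_toLp
    refine ⟨z, Prod.ext ?_ ?_⟩
    · ext i
      fin_cases i
      · exact tendsto_nhds_unique l₀ t1
      · exact tendsto_nhds_unique r₀ t2
    · ext i
      fin_cases i
      · exact tendsto_nhds_unique l₁ t3
      · exact tendsto_nhds_unique r₁ t4
  · intro y z
    obtain ⟨f, hf, hf₁, hf₂⟩ := hadj.le y.2
    obtain ⟨g, hg, hg₁, hg₂⟩ := hadj.le z.2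
    obtain ⟨a, b, ha, hb, hab⟩ := exists_tendsto_jacobiForm (f := f) (g := g) hf hg
    obtain ⟨lf₀, rf₀⟩ := hΓ₀ y f hf hf₁
    obtain ⟨lf₁, rf₁⟩ := hΓ₁ y f hf hf₁
    obtain ⟨lg₀, rg₀⟩ := hΓ₀ z g hg hg₁
    obtain ⟨lg₁, rg₁⟩ := hΓ₁ z g hg hg₁
    -- Passing to the limit in the Plücker identity evaluates -a at the left end and b at the right;
    -- their sum is the boundary term b - a of Green's formula.
    have el := tendsto_nhds_unique
      ((ha.mul (tendsto_coeff_deriv_left hβ₀ hv_left)).congr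
        fun x => jacobiForm_mul_coeff_deriv f g v x)
      ((lf₁.mul lg₀.star).sub (lf₀.mul lg₁.star))
    have er := tendsto_nhds_unique
      ((hb.mul (tendsto_coeff_deriv_right hα₀ hv_right)).congr
        fun x => jacobiForm_mul_coeff_deriv f g v x)
      ((rf₁.mul rg₀.star).sub (rf₀.mul rg₁.star))
    rw [inner_sub_inner_eq hf hg hf₁ hf₂ hg₁ hg₂, hab]
    simp only [PiLp.inner_apply, Fin.sum_univ_two, RCLike.inner_apply]
    simp only [Complex.star_def] at el er
    linear_combination el + er
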